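/- Let $P$ be a polynomial endofunctor represented by a diagram of groupoids $I \xleftarrow{s} E \xrightarrow{p} B \xrightarrow{t} I$. A *tree* is a diagram of finite sets $A \xleftarrow{s} M \xrightarrow{p} N \xrightarrow{t} A$ (edges $A$, nodes $N$, nodes with a marked input edge $M$) such that $t$ is injective, $s$ is injective with singleton complement (the root), and every edge reaches the root after finitely many steps of the walk $s(m)\mapsto t(p(m))$. Its leaves are the edges not in the image of $t$. A *$P$-tree* is a tree with maps $A\to I$, $M\to E$, $N\to B$ and specified isomorphisms filling the three squares over $I \leftarrow E \to B \to I$, the middle square being homotopy cartesian. Let $\mathbf T$ be the groupoid of $P$-trees, and assume that every $P$-tree has a finite automorphism group. A *cut* of $T$ is a subtree $S_c\subset T$ containing the root (a subtree contains, with each node, its output edge and all its input edges); $P_c$ is the forest of the ideal subtrees of $T$ generated by the leaves of $S_c$, where the ideal subtree generated by an edge consists of that edge and all edges and nodes above it. In $\mathbb{Q}[\delta_T]_{T\in\pi_0\mathbf T}$ write $\delta_{P_c}$ for the product of the $\delta$'s of the trees of $P_c$, and set $$\Delta(\delta_T)=\sum_{c\in\operatorname{cut}(T)}\delta_{P_c}\otimes\delta_{S_c}.$$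 For a colour $v\in I$ let $\mathbf T_v$ be the homotopy fibre over $v$ of the root map $\mathbf T\to I$: its objects are $P$-trees $T$ with a specified isomorphism from the root colour of $T$ to $v$, and $\operatorname{Aut}_v(T)$ denotes the automorphism group of such an object in $\mathbf T_v$. In the power series ring $\mathbb{Q}[[\delta_T]]_{T\in\pi_0\mathbf T}$ put $$G=\sum_{T\in\pi_0\mathbf T}\frac{\delta_T}{|\operatorname{Aut}(T)|},\qquad G_v=\sum_{T\in\pi_0(\mathbf T_v)}\frac{\delta_T}{|\operatorname{Aut}_v(T)|},$$ and, for each finitely supported $\mathbf n=(n_v)_{v\in\pi_0 I}$ of natural numbers (an element of $\mathbb{N}^s$ when $\pi_0 I$ has $s<\infty$ elements), $$G^{\mathbf n}=\prod_{v\in\pi_0 I}G_v^{\,n_v},\qquad g_{\mathbf n}=\sum_{T}\frac{\delta_T}{|\operatorname{Aut}(T)|},$$ the last sum being over the isomorphism classes of $P$-trees with exactly $n_v$ leaves of each colour $v\in\pi_0 I$. **Theorem.** The element $\Delta(\delta_T)$ depends only on the isomorphism class of $T$, and $\Delta$ extends to power series: for each pair of monomials, only finitely many $T\in\pi_0\mathbf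 T$ are such that $\Delta(\delta_T)$ involves it, so $\Delta$ extends to a continuous algebra homomorphism from $\mathbb{Q}[[\delta_T]]$ to its completed tensor square. The series $G_v$ are well defined: the groups $\operatorname{Aut}_v(T)$ are finite, and only finitely many classes of $\mathbf T_v$ lie over each class of $\mathbf T$. Moreover $$\Delta(G)=\sum_{\mathbf n}G^{\mathbf n}\otimes g_{\mathbf n},$$ where for each pair of monomials only finitely many terms of the sum have a nonzero coefficient. -/

import Mathlib

open CategoryTheory

namespace FaaDiBruno

universe vI vE vB uI uE uB

/-! ### Isomorphism classes and homotopy fibres of groupoids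

For a functor `F : X ⥤ Y` between groupoids, the homotopy fibre of `F` over `y` (objects: pairs
`(x, φ : F x ⟶ y)`; arrows: arrows of `X` compatible with the `φ`s) is Mathlib's
`CostructuredArrow F y`. -/

/-- `π₀ C`, the isomorphism classes of objects of `C`. -/
abbrev Pi0 (C : Type*) [Category C] : Type _ := Quotient (isIsomorphicSetoid C)

/-- The isomorphism class of an object. -/
abbrev cls {C : Type*} [Category C] (X : C) : Pi0 C := Quotient.mk (isIsomorphicSetoid C) X

/-- A family of objects of `C` indexed by a set `X` is a functor from the discrete category on `X`;
this is its action on an arrow, that is, on an equality `x = y` of indices. -/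
def famMap {X : Type*} {C : Type*} [Category C] (f : X → C) {x y : X} (h : x = y) : f x ⟶ f y :=
  eqToHom (congrArg f h)

section famMap

variable {X : Type*} {C : Type*} [Category C]

@[simp] theorem famMap_rfl (f : X → C) {x : X} (h : x = x) : famMap f h = 𝟙 _ := rfl

@[simp] theorem famMap_trans (f : X → C) {x y z : X} (h : x = y) (h' : y = z) :
    famMap f h ≫ famMap f h' = famMap f (h.trans h') := by
  subst h; subst h'; simp

@[simp] theorem famMap_trans_assoc (f : X → C) {x y z : X} (h : x = y) (h' : y = z) {W : C}
    (k : f z ⟶ W) : famMap f h ≫ famMap f h' ≫ k = famMap f (h.trans h') ≫ k := by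
  subst h; subst h'; simp

theorem famMap_natural {Y : Type*} (f : X → C) (g : Y → C) (u : X → Y)
    (θ : ∀ x, f x ⟶ g (u x)) {x y : X} (h : x = y) :
    famMap f h ≫ θ y = θ x ≫ famMap g (congrArg u h) := by
  subst h; simp

end famMap

/-- A finite family `x ↦ (ε x, φ x : p (ε x) ⟶ b)` of objects of the homotopy fibre of `p` over `b`,
as a functor from a discrete groupoid. -/
abbrev toFibre {E : Type uE} {B : Type uB} [Groupoid.{vE} E] [Groupoid.{vB} B] (p : E ⥤ B) {b : B}
    {X : Type} (ε : X → E) (φ : ∀ x, p.obj (ε x) ⟶ b) : Discrete X ⥤ CostructuredArrow p b :=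
  Discrete.functor fun x => CostructuredArrow.mk (φ x)

theorem toFibre_isEquivalence_iff {E : Type uE} {B : Type uB} [Groupoid.{vE} E] [Groupoid.{vB} B]
    (p : E ⥤ B) {b : B} {X : Type} (ε : X → E) (φ : ∀ x, p.obj (ε x) ⟶ b) :
    (toFibre p ε φ).IsEquivalence ↔
      ∀ (e : E) (f : p.obj e ⟶ b), ∃! x : Σ x, (ε x ⟶ e), p.map x.2 ≫ f = φ x.1 := by
  constructor
  · intro h e f
    obtain ⟨⟨x⟩, ⟨i⟩⟩ := (inferInstance : (toFibre p ε φ).EssSurj).mem_essImage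
      (CostructuredArrow.mk f)
    refine ⟨⟨x, i.hom.left⟩, by simpa using CostructuredArrow.w i.hom, ?_⟩
    rintro ⟨y, j⟩ hj
    let j' : (toFibre p ε φ).obj ⟨y⟩ ⟶ CostructuredArrow.mk f := CostructuredArrow.homMk j hj
    obtain ⟨k, hk⟩ := (inferInstance : (toFibre p ε φ).Full).map_surjective (j' ≫ i.inv)
    obtain rfl : y = x := Discrete.eq_of_hom k
    have hk1 : k = 𝟙 _ := Subsingleton.elim _ _
    rw [hk1, CategoryTheory.Functor.map_id] at hk
    have : j' = i.hom := by
      have := congrArg (· ≫ i.hom) hk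
      simpa using this.symm
    have := congrArg CommaMorphism.left this
    simp only [j', CostructuredArrow.homMk_left] at this
    rw [this]
  · intro h
    have key : ∀ x y : X, ∀ k : (toFibre p ε φ).obj ⟨x⟩ ⟶ (toFibre p ε φ).obj ⟨y⟩,
        (⟨x, k.left⟩ : Σ x, (ε x ⟶ ε y)) = ⟨y, 𝟙 _⟩ := fun x y k =>
      (h (ε y) (φ y)).unique (by simpa using CostructuredArrow.w k) (by simp)
    refine { faithful := ⟨fun _ => Subsingleton.elim _ _⟩, full := ⟨?_⟩, essSurj := ⟨?_⟩ }
    · rintro ⟨x⟩ ⟨y⟩ k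
      have hk := key x y k
      obtain rfl : x = y := congrArg Sigma.fst hk
      refine ⟨𝟙 _, ?_⟩
      rw [CategoryTheory.Functor.map_id]
      apply CostructuredArrow.hom_ext
      have := eq_of_heq (Sigma.mk.inj hk).2
      exact this.symm
    · intro Y
      obtain ⟨⟨x, i⟩, hi, -⟩ := h Y.left Y.hom
      exact ⟨⟨x⟩, ⟨CostructuredArrow.isoMk (asIso i) (by simpa using hi)⟩⟩

/-! ### Trees -/

open Classical in
/-- The walk-to-the-root function of a diagram `A ←s- M -p→ N -t→ A`:
`s m ↦ t (p m)`, and edges outside the image of `s` are fixed. -/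
noncomputable def walk {A M N : Type} (s : M → A) (p : M → N) (t : N → A) (a : A) : A :=
  if h : ∃ m, s m = a then t (p h.choose) else a

/-- A finite (operadic) tree: a diagram `A ←s- M -p→ N -t→ A` of finite sets
(`A` edges, `N` nodes, `M` nodes with a marked input edge). -/
structure Tree where
  A : Type
  M : Type
  N : Type
  [finite_A : Finite A]
  [finite_M : Finite M]
  [finite_N : Finite N]
  s : M → A
  p : M → N
  t : N → A
  root : A
  t_injective : Function.Injective t
  s_injective : Function.Injective s
  compl_range_s : (Set.range s)ᶜ = {root}
  walk_root : ∀ a, ∃ k : ℕ, (walk s p t)^[k] a = root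

attribute [instance] Tree.finite_A Tree.finite_M Tree.finite_N

namespace Tree

variable (T : Tree)

theorem s_ne_root (m : T.M) : T.s m ≠ T.root := fun h => by
  have : T.root ∈ (Set.range T.s)ᶜ := by rw [T.compl_range_s]; rfl
  exact this ⟨m, h⟩

theorem exists_s {a : T.A} (h : a ≠ T.root) : ∃ m, T.s m = a := by
  by_contra h'
  exact h (by simpa [T.compl_range_s] using (show a ∈ (Set.range T.s)ᶜ from h'))

/-- A leaf is an edge which is not the output edge of a node. -/
abbrev Leaf : Type := {a : T.A // a ∉ Set.range T.t}

noncomputable instance : Fintype T.Leaf := Fintype.ofFinite _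

end Tree

theorem walk_s {A M N : Type} {s : M → A} (hs : Function.Injective s) (p : M → N) (t : N → A)
    (m : M) : walk s p t (s m) = t (p m) := by
  have h : ∃ m', s m' = s m := ⟨m, rfl⟩
  rw [walk, dif_pos h, hs h.choose_spec]

theorem walk_of_notMem {A M N : Type} {s : M → A} (p : M → N) (t : N → A) {a : A}
    (h : a ∉ Set.range s) : walk s p t a = a := dif_neg h

/-- The subtrees of `T` with root edge `r`, given by their edges and nodes. Together with a node, a
subtree contains its output edge and all its input edges; every edge of the subtree except `r`, and
not `r`, is an input edge of a node of the subtree. -/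
@[ext]
structure Subtree (T : Tree) (r : T.A) where
  edges : Set T.A
  nodes : Set T.N
  root_mem : r ∈ edges
  output_mem : ∀ n ∈ nodes, T.t n ∈ edges
  input_mem : ∀ m, T.p m ∈ nodes → T.s m ∈ edges
  input_ne_root : ∀ m, T.p m ∈ nodes → T.s m ≠ r
  exists_input : ∀ a ∈ edges, a ≠ r → ∃ m, T.p m ∈ nodes ∧ T.s m = a

instance (T : Tree) (r : T.A) : Finite (Subtree T r) :=
  Finite.of_injective (fun S : Subtree T r => (S.edges, S.nodes)) fun _ _ h =>
    Subtree.ext (congrArg Prod.fst h) (congrArg Prod.snd h)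

namespace Subtree

variable {T : Tree} {r : T.A} (S : Subtree T r)

/-- A subtree, as a tree. -/
@[simps A M N root]
def toTree : Tree where
  A := S.edges
  M := {m : T.M // T.p m ∈ S.nodes}
  N := S.nodes
  s m := ⟨T.s m.1, S.input_mem _ m.2⟩
  p m := ⟨T.p m.1, m.2⟩
  t n := ⟨T.t n.1, S.output_mem _ n.2⟩
  root := ⟨r, S.root_mem⟩
  t_injective n n' h := Subtype.ext (T.t_injective (congrArg Subtype.val h))
  s_injective m m' h := Subtype.ext (T.s_injective (congrArg Subtype.val h))
  compl_range_s := by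
    ext ⟨a, ha⟩
    simp only [Set.mem_compl_iff, Set.mem_range, Set.mem_singleton_iff, Subtype.mk.injEq,
      Subtype.exists]
    constructor
    · intro h
      by_contra hne
      obtain ⟨m, hm, hma⟩ := S.exists_input a ha hne
      exact h ⟨m, hm, hma⟩
    · rintro rfl ⟨m, hm, hma⟩
      exact S.input_ne_root m hm hma
  walk_root := by
    have hs : Function.Injective
        (fun m : {m : T.M // T.p m ∈ S.nodes} => (⟨T.s m.1, S.input_mem _ m.2⟩ : S.edges)) :=
      fun m m' h => Subtype.ext (T.s_injective (congrArg Subtype.val h))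
    have main : ∀ (k : ℕ) (a : S.edges), (walk T.s T.p T.t)^[k] a.1 = T.root → ∃ k : ℕ,
        (walk (fun m : {m : T.M // T.p m ∈ S.nodes} => (⟨T.s m.1, S.input_mem _ m.2⟩ : S.edges))
          (fun m => (⟨T.p m.1, m.2⟩ : S.nodes))
          (fun n => ⟨T.t n.1, S.output_mem _ n.2⟩))^[k] a = ⟨r, S.root_mem⟩ := by
      intro k
      induction k with
      | zero =>
        rintro ⟨a, ha⟩ h
        refine ⟨0, Subtype.ext ?_⟩
        by_contra hne
        obtain ⟨m, -, hma⟩ := S.exists_input a ha hne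
        exact T.s_ne_root m (hma.trans h)
      | succ k ih =>
        rintro ⟨a, ha⟩ h
        by_cases hne : a = r
        · subst hne
          exact ⟨0, rfl⟩
        · obtain ⟨m, hm, rfl⟩ := S.exists_input a ha hne
          rw [Function.iterate_succ_apply, walk_s T.s_injective] at h
          obtain ⟨k', hk'⟩ := ih ⟨T.t (T.p m), S.output_mem _ hm⟩ h
          refine ⟨k' + 1, ?_⟩
          rw [Function.iterate_succ_apply]
          have := walk_s hs (fun m => (⟨T.p m.1, m.2⟩ : S.nodes))
            (fun n => (⟨T.t n.1, S.output_mem _ n.2⟩ : S.edges)) ⟨m, hm⟩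
          rw [this]
          exact hk'
    intro a
    obtain ⟨k, hk⟩ := T.walk_root a.1
    exact main k a hk

end Subtree

namespace Tree

variable (T : Tree)

/-- The cuts of a tree: its subtrees containing the root. -/
abbrev Cut : Type := Subtree T T.root

noncomputable instance : Fintype T.Cut := Fintype.ofFinite _

/-- The edge `e` lies on the walk from `a` to the root, that is, `a` is `e` or is above `e`. -/
def IsAbove (e a : T.A) : Prop := ∃ k : ℕ, (walk T.s T.p T.t)^[k] a = e

theorem walk_iterate_root (k : ℕ) : (walk T.s T.p T.t)^[k] T.root = T.root := by
  refine Function.iterate_fixed (walk_of_notMem _ _ ?_) k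
  rintro ⟨m, hm⟩
  exact T.s_ne_root m hm

theorem not_isAbove_output (m : T.M) : ¬ T.IsAbove (T.s m) (T.t (T.p m)) := by
  rintro ⟨k, hk⟩
  have hper : (walk T.s T.p T.t)^[k + 1] (T.s m) = T.s m := by
    rw [Function.iterate_succ_apply, walk_s T.s_injective, hk]
  obtain ⟨j, hj⟩ := T.walk_root (T.s m)
  have h1 : (walk T.s T.p T.t)^[(k + 1) * j] (T.s m) = T.s m := by
    rw [Function.iterate_mul]
    exact Function.iterate_fixed hper j
  rw [show (k + 1) * j = k * j + j by ring, Function.iterate_add_apply, hj,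
    T.walk_iterate_root] at h1
  exact T.s_ne_root m h1.symm

/-- The ideal subtree generated by an edge `e`: the edge `e` and all edges and nodes above it. -/
def ideal (e : T.A) : Subtree T e where
  edges := {a | T.IsAbove e a}
  nodes := {n | T.IsAbove e (T.t n)}
  root_mem := ⟨0, rfl⟩
  output_mem _ h := h
  input_mem m := by
    rintro ⟨k, hk⟩
    exact ⟨k + 1, by rw [Function.iterate_succ_apply, walk_s T.s_injective, hk]⟩
  input_ne_root m h := by
    rintro rfl
    exact T.not_isAbove_output m h
  exists_input a := by
    rintro ⟨k, hk⟩ hne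
    have hr : a ≠ T.root := by
      rintro rfl
      rw [T.walk_iterate_root] at hk
      exact hne hk
    obtain ⟨m, rfl⟩ := T.exists_s hr
    refine ⟨m, ?_, rfl⟩
    cases k with
    | zero => exact absurd hk hne
    | succ k =>
      rw [Function.iterate_succ_apply, walk_s T.s_injective] at hk
      exact ⟨k, hk⟩

end Tree

/-! ### `P`-trees -/

/-- The data `I ←s- E -p→ B -t→ I` representing a polynomial endofunctor. -/
structure PolyEndo (I : Type uI) (E : Type uE) (B : Type uB)
    [Groupoid.{vI} I] [Groupoid.{vE} E] [Groupoid.{vB} B] where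
  s : E ⥤ I
  p : E ⥤ B
  t : B ⥤ I

variable {I : Type uI} {E : Type uE} {B : Type uB}
  [Groupoid.{vI} I] [Groupoid.{vE} E] [Groupoid.{vB} B]

/-- A `P`-tree: a tree `A ← M → N → A` with decorations `α : A → I`, `ε : M → E`, `β : N → B` and
specified isomorphisms filling the three squares, the middle square being homotopy cartesian:
for each node `n`, the set of input edges of `n` is identified with the homotopy fibre of
`E → B` over `β n`. -/
structure PTree (P : PolyEndo I E B) extends Tree where
  α : A → I
  ε : M → E
  β : N → B
  sIso : ∀ m, P.s.obj (ε m) ⟶ α (s m)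
  pIso : ∀ m, P.p.obj (ε m) ⟶ β (p m)
  tIso : ∀ n, P.t.obj (β n) ⟶ α (t n)
  cartesian : ∀ n, (toFibre P.p (fun m : {m // p m = n} => ε m.1)
    (fun m => pIso m.1 ≫ famMap β m.2)).IsEquivalence

namespace PTree

variable {P : PolyEndo I E B}

/-- Isomorphisms of `P`-trees: isomorphisms of the underlying trees, with 2-cells between the
decorations that are compatible with the isomorphisms filling the squares. -/
structure Hom (T T' : PTree P) where
  edge : T.A ≃ T'.A
  mark : T.M ≃ T'.M
  node : T.N ≃ T'.N
  s_comm : ∀ m, edge (T.s m) = T'.s (mark m)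
  p_comm : ∀ m, node (T.p m) = T'.p (mark m)
  t_comm : ∀ n, edge (T.t n) = T'.t (node n)
  θα : ∀ a, T.α a ⟶ T'.α (edge a)
  θε : ∀ m, T.ε m ⟶ T'.ε (mark m)
  θβ : ∀ n, T.β n ⟶ T'.β (node n)
  s_nat : ∀ m, P.s.map (θε m) ≫ T'.sIso (mark m) =
    T.sIso m ≫ θα (T.s m) ≫ famMap T'.α (s_comm m)
  p_nat : ∀ m, P.p.map (θε m) ≫ T'.pIso (mark m) =
    T.pIso m ≫ θβ (T.p m) ≫ famMap T'.β (p_comm m)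
  t_nat : ∀ n, P.t.map (θβ n) ≫ T'.tIso (node n) =
    T.tIso n ≫ θα (T.t n) ≫ famMap T'.α (t_comm n)

theorem Hom.ext' {T T' : PTree P} {f g : Hom T T'}
    (h1 : ∀ a, f.edge a = g.edge a) (h2 : ∀ m, f.mark m = g.mark m) (h3 : ∀ n, f.node n = g.node n)
    (h4 : ∀ a, f.θα a ≫ famMap T'.α (h1 a) = g.θα a)
    (h5 : ∀ m, f.θε m ≫ famMap T'.ε (h2 m) = g.θε m)
    (h6 : ∀ n, f.θβ n ≫ famMap T'.β (h3 n) = g.θβ n) : f = g := by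
  obtain ⟨e, m, n, _, _, _, a, b, c, _, _, _⟩ := f
  obtain ⟨e', m', n', _, _, _, a', b', c', _, _, _⟩ := g
  obtain rfl : e = e' := Equiv.ext h1
  obtain rfl : m = m' := Equiv.ext h2
  obtain rfl : n = n' := Equiv.ext h3
  obtain rfl : a = a' := funext fun x => by simpa using h4 x
  obtain rfl : b = b' := funext fun x => by simpa using h5 x
  obtain rfl : c = c' := funext fun x => by simpa using h6 x
  rfl

/-- The identity. -/
@[simps]
def Hom.id (T : PTree P) : Hom T T where
  edge := Equiv.refl _
  mark := Equiv.refl _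
  node := Equiv.refl _
  s_comm _ := rfl
  p_comm _ := rfl
  t_comm _ := rfl
  θα _ := 𝟙 _
  θε _ := 𝟙 _
  θβ _ := 𝟙 _
  s_nat m := by
    change P.s.map (𝟙 (T.ε m)) ≫ T.sIso m = T.sIso m ≫ 𝟙 (T.α (T.s m)) ≫ 𝟙 (T.α (T.s m))
    simp
  p_nat m := by
    change P.p.map (𝟙 (T.ε m)) ≫ T.pIso m = T.pIso m ≫ 𝟙 (T.β (T.p m)) ≫ 𝟙 (T.β (T.p m))
    simp
  t_nat n := by
    change P.t.map (𝟙 (T.β n)) ≫ T.tIso n = T.tIso n ≫ 𝟙 (T.α (T.t n)) ≫ 𝟙 (T.α (T.t n))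
    simp

/-- Composition. -/
@[simps]
def Hom.comp {T T' T'' : PTree P} (f : Hom T T') (g : Hom T' T'') : Hom T T'' where
  edge := f.edge.trans g.edge
  mark := f.mark.trans g.mark
  node := f.node.trans g.node
  s_comm m := by simp [f.s_comm, g.s_comm]
  p_comm m := by simp [f.p_comm, g.p_comm]
  t_comm n := by simp [f.t_comm, g.t_comm]
  θα a := f.θα a ≫ g.θα _
  θε m := f.θε m ≫ g.θε _
  θβ n := f.θβ n ≫ g.θβ _
  s_nat m := by
    have h := famMap_natural T'.α T''.α g.edge g.θα (f.s_comm m)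
    simp only [Functor.map_comp, Category.assoc, Equiv.trans_apply]
    rw [g.s_nat, ← Category.assoc, f.s_nat]
    simp only [Category.assoc]
    rw [← Category.assoc (famMap _ _), h]
    simp
  p_nat m := by
    have h := famMap_natural T'.β T''.β g.node g.θβ (f.p_comm m)
    simp only [Functor.map_comp, Category.assoc, Equiv.trans_apply]
    rw [g.p_nat, ← Category.assoc, f.p_nat]
    simp only [Category.assoc]
    rw [← Category.assoc (famMap _ _), h]
    simp
  t_nat n := by
    have h := famMap_natural T'.α T''.α g.edge g.θα (f.t_comm n)
    simp only [Functor.map_comp, Category.assoc, Equiv.trans_apply]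
    rw [g.t_nat, ← Category.assoc, f.t_nat]
    simp only [Category.assoc]
    rw [← Category.assoc (famMap _ _), h]
    simp

/-- The inverse. -/
@[simps]
def Hom.inv {T T' : PTree P} (f : Hom T T') : Hom T' T where
  edge := f.edge.symm
  mark := f.mark.symm
  node := f.node.symm
  s_comm m := by rw [Equiv.symm_apply_eq, f.s_comm, Equiv.apply_symm_apply]
  p_comm m := by rw [Equiv.symm_apply_eq, f.p_comm, Equiv.apply_symm_apply]
  t_comm n := by rw [Equiv.symm_apply_eq, f.t_comm, Equiv.apply_symm_apply]
  θα a := famMap T'.α (f.edge.apply_symm_apply a).symm ≫ Groupoid.inv (f.θα (f.edge.symm a))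
  θε m := famMap T'.ε (f.mark.apply_symm_apply m).symm ≫ Groupoid.inv (f.θε (f.mark.symm m))
  θβ n := famMap T'.β (f.node.apply_symm_apply n).symm ≫ Groupoid.inv (f.θβ (f.node.symm n))
  s_nat m := by
    have key : ∀ (m : T.M) (m' : T'.M) (a : T.A) (hm : m' = f.mark m) (ha : T'.s m' = f.edge a)
        (h : a = T.s m), P.s.map (famMap T'.ε hm ≫ Groupoid.inv (f.θε m)) ≫ T.sIso m =
          T'.sIso m' ≫ (famMap T'.α ha ≫ Groupoid.inv (f.θα a)) ≫ famMap T.α h := by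
      rintro m _ _ rfl ha rfl
      have h := f.s_nat m
      have h' : T'.sIso (f.mark m) = P.s.map (Groupoid.inv (f.θε m)) ≫ T.sIso m ≫
          f.θα (T.s m) ≫ famMap T'.α (f.s_comm m) := by
        rw [← h, ← Category.assoc, ← Functor.map_comp]; simp
      rw [h']; simp
    exact key _ _ _ _ _ _
  p_nat m := by
    have key : ∀ (m : T.M) (m' : T'.M) (a : T.N) (hm : m' = f.mark m) (ha : T'.p m' = f.node a)
        (h : a = T.p m), P.p.map (famMap T'.ε hm ≫ Groupoid.inv (f.θε m)) ≫ T.pIso m =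
          T'.pIso m' ≫ (famMap T'.β ha ≫ Groupoid.inv (f.θβ a)) ≫ famMap T.β h := by
      rintro m _ _ rfl ha rfl
      have h := f.p_nat m
      have h' : T'.pIso (f.mark m) = P.p.map (Groupoid.inv (f.θε m)) ≫ T.pIso m ≫
          f.θβ (T.p m) ≫ famMap T'.β (f.p_comm m) := by
        rw [← h, ← Category.assoc, ← Functor.map_comp]; simp
      rw [h']; simp
    exact key _ _ _ _ _ _
  t_nat n := by
    have key : ∀ (n : T.N) (n' : T'.N) (a : T.A) (hm : n' = f.node n) (ha : T'.t n' = f.edge a)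
        (h : a = T.t n), P.t.map (famMap T'.β hm ≫ Groupoid.inv (f.θβ n)) ≫ T.tIso n =
          T'.tIso n' ≫ (famMap T'.α ha ≫ Groupoid.inv (f.θα a)) ≫ famMap T.α h := by
      rintro n _ _ rfl ha rfl
      have h := f.t_nat n
      have h' : T'.tIso (f.node n) = P.t.map (Groupoid.inv (f.θβ n)) ≫ T.tIso n ≫
          f.θα (T.t n) ≫ famMap T'.α (f.t_comm n) := by
        rw [← h, ← Category.assoc, ← Functor.map_comp]; simp
      rw [h']; simp
    exact key _ _ _ _ _ _

/-- The groupoid of `P`-trees. -/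
instance : Groupoid.{max vI vE vB} (PTree P) where
  Hom := Hom
  id := Hom.id
  comp := Hom.comp
  inv := Hom.inv
  id_comp f := Hom.ext' (fun _ => rfl) (fun _ => rfl) (fun _ => rfl)
    (fun _ => (Category.comp_id _).trans (Category.id_comp _))
    (fun _ => (Category.comp_id _).trans (Category.id_comp _))
    (fun _ => (Category.comp_id _).trans (Category.id_comp _))
  comp_id f := Hom.ext' (fun _ => rfl) (fun _ => rfl) (fun _ => rfl)
    (fun _ => (Category.comp_id _).trans (Category.comp_id _))
    (fun _ => (Category.comp_id _).trans (Category.comp_id _))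
    (fun _ => (Category.comp_id _).trans (Category.comp_id _))
  assoc f g h := Hom.ext' (fun _ => rfl) (fun _ => rfl) (fun _ => rfl)
    (fun _ => (Category.comp_id _).trans (Category.assoc _ _ _))
    (fun _ => (Category.comp_id _).trans (Category.assoc _ _ _))
    (fun _ => (Category.comp_id _).trans (Category.assoc _ _ _))
  inv_comp {T T'} f := Hom.ext' (fun a => f.edge.apply_symm_apply a)
    (fun m => f.mark.apply_symm_apply m) (fun n => f.node.apply_symm_apply n)
    (fun a => by
      have key : ∀ (b : _) (h : a = f.edge b), ((famMap T'.α h ≫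
          Groupoid.inv (f.θα b)) ≫ f.θα b) ≫ famMap T'.α h.symm = 𝟙 _ := by
        rintro b h; simp
      exact key _ _)
    (fun a => by
      have key : ∀ (b : _) (h : a = f.mark b), ((famMap T'.ε h ≫
          Groupoid.inv (f.θε b)) ≫ f.θε b) ≫ famMap T'.ε h.symm = 𝟙 _ := by
        rintro b h; simp
      exact key _ _)
    (fun a => by
      have key : ∀ (b : _) (h : a = f.node b), ((famMap T'.β h ≫
          Groupoid.inv (f.θβ b)) ≫ f.θβ b) ≫ famMap T'.β h.symm = 𝟙 _ := by
        rintro b h; simp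
      exact key _ _)
  comp_inv {T T'} f := Hom.ext' (fun a => f.edge.symm_apply_apply a)
    (fun m => f.mark.symm_apply_apply m) (fun n => f.node.symm_apply_apply n)
    (fun a => by
      have key : ∀ b (h : f.edge a = f.edge b) (h' : b = a), (f.θα a ≫ famMap T'.α h ≫
          Groupoid.inv (f.θα b)) ≫ famMap T.α h' = 𝟙 _ := by
        rintro _ h rfl; simp
      exact key _ _ _)
    (fun a => by
      have key : ∀ b (h : f.mark a = f.mark b) (h' : b = a), (f.θε a ≫ famMap T'.ε h ≫
          Groupoid.inv (f.θε b)) ≫ famMap T.ε h' = 𝟙 _ := by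
        rintro _ h rfl; simp
      exact key _ _ _)
    (fun a => by
      have key : ∀ b (h : f.node a = f.node b) (h' : b = a), (f.θβ a ≫ famMap T'.β h ≫
          Groupoid.inv (f.θβ b)) ≫ famMap T.β h' = 𝟙 _ := by
        rintro _ h rfl; simp
      exact key _ _ _)

theorem edge_root {T T' : PTree P} (f : T ⟶ T') : Hom.edge f T.root = T'.root := by
  by_contra h
  obtain ⟨m, hm⟩ := T'.exists_s h
  apply T.s_ne_root ((Hom.mark f).symm m)
  apply (Hom.edge f).injective
  rw [Hom.s_comm, Equiv.apply_symm_apply, hm]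

/-- The root map `R`, sending a `P`-tree to the decoration of its root. -/
@[simps]
def rootMap (P : PolyEndo I E B) : PTree P ⥤ I where
  obj T := T.α T.root
  map {T T'} f := Hom.θα f T.root ≫ famMap T'.α (edge_root f)
  map_id T := by
    exact Category.comp_id _
  map_comp {T T' T''} f g := by
    have h := famMap_natural T'.α T''.α (Hom.edge g) (Hom.θα g) (edge_root f)
    change (Hom.θα f _ ≫ Hom.θα g _) ≫ famMap T''.α _ = _
    simp only [Category.assoc]
    rw [← Category.assoc (famMap _ _), h]
    simp

/-- A subtree of a `P`-tree, with the restricted decorations. -/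
def sub (T : PTree P) {r : T.A} (S : Subtree T.toTree r) : PTree P where
  toTree := S.toTree
  α a := T.α a.1
  ε m := T.ε m.1
  β n := T.β n.1
  sIso m := T.sIso m.1
  pIso m := T.pIso m.1
  tIso n := T.tIso n.1
  cartesian := by
    rintro ⟨n, hn⟩
    rw [toFibre_isEquivalence_iff]
    intro e f
    obtain ⟨⟨⟨m, rfl⟩, j⟩, hj, huniq⟩ := (toFibre_isEquivalence_iff _ _ _).1 (T.cartesian n) e f
    refine ⟨⟨⟨⟨m, hn⟩, rfl⟩, j⟩, hj, ?_⟩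
    rintro ⟨⟨⟨m', hm'⟩, hm''⟩, j'⟩ hj'
    have hp : T.p m' = T.p m := congrArg Subtype.val hm''
    have := huniq ⟨⟨m', hp⟩, j'⟩ hj'
    have hmm : m' = m := congrArg (fun x => x.1.1) this
    subst hmm
    have hjj : j' = j := eq_of_heq (Sigma.mk.inj this).2
    subst hjj
    rfl

/-- The leaf profile of a `P`-tree: the number of leaves of each colour. -/
noncomputable def leafProfile (T : PTree P) : Pi0 I →₀ ℕ :=
  ∑ l : T.Leaf, Finsupp.single (cls (T.α l.1)) 1

end PTree

/-! ### The completed bialgebra and the Green functions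

`ℚ[[δ_T]]`, `T ∈ π₀ T`, is `MvPowerSeries (Pi0 (PTree P)) ℚ`, whose monomials are the isomorphism
classes of `P`-forests. The completed tensor square of `ℚ[[δ_x]]`, `x ∈ σ`, is the ring
of power series in the variables `δ_x ⊗ 1` (indexed by `Sum.inl x`) and `1 ⊗ δ_x`
(indexed by `Sum.inr x`). -/

/-- The external product `f ⊗ g`. -/
noncomputable def tensor {σ : Type*} (f g : MvPowerSeries σ ℚ) : MvPowerSeries (σ ⊕ σ) ℚ := fun d =>
  MvPowerSeries.coeff (Finsupp.sumFinsuppEquivProdFinsupp d).1 f *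
    MvPowerSeries.coeff (Finsupp.sumFinsuppEquivProdFinsupp d).2 g

/-- `a` is the sum of the family `f` in the topology of coefficientwise stabilisation: in each
degree only finitely many members of the family have a nonzero coefficient. -/
def IsFormalSum {κ σ : Type*} (f : κ → MvPowerSeries σ ℚ) (a : MvPowerSeries σ ℚ) : Prop :=
  ∀ d, {k | MvPowerSeries.coeff d (f k) ≠ 0}.Finite ∧
    MvPowerSeries.coeff d a = ∑ᶠ k, MvPowerSeries.coeff d (f k)

namespace PolyEndo

variable (P : PolyEndo I E B)

/-- The variable `δ_T`. -/
noncomputable abbrev δ (T : PTree P) : MvPowerSeries (Pi0 (PTree P)) ℚ := MvPowerSeries.X (cls T)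

/-- The monomial `δ_{P_c}` of the forest `P_c` found above a cut `c : S ⊆ T`, consisting of the ideal
subtrees of `T` generated by the leaves of `S`. -/
noncomputable def δAbove (T : PTree P) (c : T.Cut) : MvPowerSeries (Pi0 (PTree P)) ℚ :=
  ∏ l : c.toTree.Leaf, P.δ (T.sub (T.ideal l.1.1))

/-- `∑_{c ∈ cut(T)} δ_{P_c} ⊗ δ_{S_c}`. -/
noncomputable def cutSum (T : PTree P) :
    MvPowerSeries (Pi0 (PTree P) ⊕ Pi0 (PTree P)) ℚ :=
  ∑ c : T.Cut, tensor (P.δAbove T c) (P.δ (T.sub c))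

/-- The comultiplication on the generator `δ_x`, for an isomorphism class `x` of `P`-trees. -/
noncomputable def comulGen (x : Pi0 (PTree P)) :
    MvPowerSeries (Pi0 (PTree P) ⊕ Pi0 (PTree P)) ℚ :=
  P.cutSum x.out

/-- The comultiplication on power series: the continuous algebra homomorphism with the prescribed
values on generators. -/
noncomputable def comul (f : MvPowerSeries (Pi0 (PTree P)) ℚ) :
    MvPowerSeries (Pi0 (PTree P) ⊕ Pi0 (PTree P)) ℚ :=
  MvPowerSeries.subst P.comulGen f

variable {P}

/-- The finiteness that relative cardinality presupposes: only finitely many isomorphism classes of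
the groupoid `X` lie over any class of `P`-trees, and the vertex groups of `X` are finite. -/
def RelFinite {X : Type*} [Category X] (F : X ⥤ PTree P) : Prop :=
  (∀ y : Pi0 (PTree P), {x : Pi0 X | cls (F.obj x.out) = y}.Finite) ∧ ∀ x : X, Finite (Aut x)

open Classical in
/-- The relative cardinality `∑_{x ∈ π₀ X} δ_{F x} / |Aut x|` of a groupoid `X` over the groupoid of
`P`-trees. -/
noncomputable def relCard {X : Type*} [Category X] (F : X ⥤ PTree P) :
    MvPowerSeries (Pi0 (PTree P)) ℚ := fun d =>
  ∑ᶠ x : Pi0 X, MvPowerSeries.coeff d ((Nat.card (Aut x.out) : ℚ)⁻¹ • P.δ (F.obj x.out))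

variable (P)

/-- The Green function `G = ∑_T δ_T / |Aut T|`. -/
noncomputable def green : MvPowerSeries (Pi0 (PTree P)) ℚ := relCard (𝟭 (PTree P))

/-- The Green function `G_v` of trees of root colour `v`: the relative cardinality of the homotopy
fibre of the root map over `v`. -/
noncomputable def greenRoot (v : I) : MvPowerSeries (Pi0 (PTree P)) ℚ :=
  relCard (CostructuredArrow.proj (PTree.rootMap P) v)

/-- `G^n = ∏_v G_v ^ n_v`. -/
noncomputable def greenPow (n : Pi0 I →₀ ℕ) : MvPowerSeries (Pi0 (PTree P)) ℚ :=
  n.prod fun v k => P.greenRoot v.out ^ k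

/-- `g_n`, the summand of `G` given by the trees with `n_v` leaves of each colour `v`. -/
noncomputable def greenLeaf (n : Pi0 I →₀ ℕ) : MvPowerSeries (Pi0 (PTree P)) ℚ :=
  relCard (ObjectProperty.ι fun T : PTree P => T.leafProfile = n)

end PolyEndo

end FaaDiBruno

/-!
The Faà di Bruno formula `Δ(G) = ∑_n G^n ⊗ g_n` holds because cutting trees and grafting trees are
inverse to each other, once both are counted with their isomorphisms.

Morphisms of diagrams over `I ← E → B → I` between `P`-trees (`PTree.Mor`) are automatically
injective (`PTree.Mor.edge_injective`), because the middle squares are cartesian. Hence a cut of `T`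
with an identification of its trunk with `S` is an embedding of `S` preserving the root
(`PTree.cutHomEquiv`), and an identification of `F` with the ideal subtree generated by `e` is a
leaf-preserving embedding of `F` with root `e` (`PTree.idealHomEquiv`). Together such embeddings of
`S` and of trees `F l`, for `l` a leaf of `S`, form a decomposition of `T` (`PTree.Decomp`). Grafting
the `F l` onto `S` along isomorphisms `h l` from the root colour of `F l` to the colour of `l`
produces a tree `PTree.graft h` with the universal property that decompositions of `T` are the pairs
of a gluing datum `h` and an isomorphism `graft h ⟶ T` (`PTree.Decomp.equiv`).

Counting decompositions in two ways (`PTree.card_cuts`) expresses the coefficients of `Δ(δ_T)`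
through the numbers of isomorphisms `graft h ⟶ T`. These depend only on the class of `T`, and
vanish for all but the finitely many classes of the trees `graft h`; this gives the invariance of
`Δ(δ_T)` and the extension of `Δ` to power series. Moreover the sum over all classes of trees `T` of
the number of isomorphisms `graft h ⟶ T`, divided by `|Aut T|`, is 1. So the coefficient of `Δ(G)`
at a forest and a tree `S` is `1 / |Aut S|` times the number of gluing data for `S` and the forest,
weighted by the automorphisms of the trees of the forest. By the orbit-stabilizer theorem
(`card_costructuredArrow`), the coefficient of `G_v` at a tree `F` is the number of isomorphisms from
the root colour of `F` to `v` divided by `|Aut F|`, so the product of the `G_v` over the leaves of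
`S` has the same coefficient (`PolyEndo.coeff_comul_green_of_eq`).
-/

namespace FaaDiBruno

universe vI vE vB uI uE uB

variable {I : Type uI} {E : Type uE} {B : Type uB}
  [Groupoid.{vI} I] [Groupoid.{vE} E] [Groupoid.{vB} B] {P : PolyEndo I E B}

/-! ### Embeddings of `P`-trees -/

/-- Induction from the root upwards. -/
theorem Tree.edge_induction (T : Tree) {Q : T.A → Prop} (root : Q T.root)
    (step : ∀ m, Q (T.t (T.p m)) → Q (T.s m)) (a : T.A) : Q a := by
  obtain ⟨k, hk⟩ := T.walk_root a
  induction k generalizing a with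
  | zero => exact (show a = T.root from hk) ▸ root
  | succ k ih =>
    by_cases ha : a = T.root
    · exact ha ▸ root
    · obtain ⟨m, rfl⟩ := T.exists_s ha
      rw [Function.iterate_succ_apply, walk_s T.s_injective] at hk
      exact step m (ih _ hk)

theorem Tree.isAbove_s {T : Tree} {e : T.A} {m : T.M} (h : T.IsAbove e (T.t (T.p m))) :
    T.IsAbove e (T.s m) := by
  obtain ⟨k, hk⟩ := h
  exact ⟨k + 1, by rw [Function.iterate_succ_apply, walk_s T.s_injective, hk]⟩

namespace PTree

/-- Morphisms of diagrams over `I ← E → B → I`: as `PTree.Hom`, but the maps on edges, nodes and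
marks are arbitrary. As the middle squares of both `P`-trees are homotopy cartesian, these are
exactly the embeddings of `T` into `T'` as a subtree. -/
structure Mor (T T' : PTree P) where
  edge : T.A → T'.A
  mark : T.M → T'.M
  node : T.N → T'.N
  s_comm : ∀ m, edge (T.s m) = T'.s (mark m)
  p_comm : ∀ m, node (T.p m) = T'.p (mark m)
  t_comm : ∀ n, edge (T.t n) = T'.t (node n)
  θα : ∀ a, T.α a ⟶ T'.α (edge a)
  θε : ∀ m, T.ε m ⟶ T'.ε (mark m)
  θβ : ∀ n, T.β n ⟶ T'.β (node n)
  s_nat : ∀ m, P.s.map (θε m) ≫ T'.sIso (mark m) =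
    T.sIso m ≫ θα (T.s m) ≫ famMap T'.α (s_comm m)
  p_nat : ∀ m, P.p.map (θε m) ≫ T'.pIso (mark m) =
    T.pIso m ≫ θβ (T.p m) ≫ famMap T'.β (p_comm m)
  t_nat : ∀ n, P.t.map (θβ n) ≫ T'.tIso (node n) =
    T.tIso n ≫ θα (T.t n) ≫ famMap T'.α (t_comm n)

namespace Mor

variable {T T' T'' : PTree P}

theorem ext' {f g : Mor T T'}
    (h1 : ∀ a, f.edge a = g.edge a) (h2 : ∀ m, f.mark m = g.mark m) (h3 : ∀ n, f.node n = g.node n)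
    (h4 : ∀ a, f.θα a ≫ famMap T'.α (h1 a) = g.θα a)
    (h5 : ∀ m, f.θε m ≫ famMap T'.ε (h2 m) = g.θε m)
    (h6 : ∀ n, f.θβ n ≫ famMap T'.β (h3 n) = g.θβ n) : f = g := by
  obtain ⟨e, m, n, _, _, _, a, b, c, _, _, _⟩ := f
  obtain ⟨e', m', n', _, _, _, a', b', c', _, _, _⟩ := g
  obtain rfl : e = e' := funext h1
  obtain rfl : m = m' := funext h2
  obtain rfl : n = n' := funext h3
  obtain rfl : a = a' := funext fun x => by simpa using h4 x
  obtain rfl : b = b' := funext fun x => by simpa using h5 x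
  obtain rfl : c = c' := funext fun x => by simpa using h6 x
  rfl

theorem edge_congr {f g : Mor T T'} (h : f = g) (a : T.A) : f.edge a = g.edge a := by rw [h]

theorem mark_congr {f g : Mor T T'} (h : f = g) (m : T.M) : f.mark m = g.mark m := by rw [h]

theorem node_congr {f g : Mor T T'} (h : f = g) (n : T.N) : f.node n = g.node n := by rw [h]

theorem θα_congr {f g : Mor T T'} (h : f = g) (a : T.A) :
    f.θα a ≫ famMap T'.α (edge_congr h a) = g.θα a := by subst h; simp

theorem θε_congr {f g : Mor T T'} (h : f = g) (m : T.M) :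
    f.θε m ≫ famMap T'.ε (mark_congr h m) = g.θε m := by subst h; simp

theorem θβ_congr {f g : Mor T T'} (h : f = g) (n : T.N) :
    f.θβ n ≫ famMap T'.β (node_congr h n) = g.θβ n := by subst h; simp

/-- Composition. -/
@[simps]
def comp (f : Mor T T') (g : Mor T' T'') : Mor T T'' where
  edge := g.edge ∘ f.edge
  mark := g.mark ∘ f.mark
  node := g.node ∘ f.node
  s_comm m := by simp [f.s_comm, g.s_comm]
  p_comm m := by simp [f.p_comm, g.p_comm]
  t_comm n := by simp [f.t_comm, g.t_comm]
  θα a := f.θα a ≫ g.θα _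
  θε m := f.θε m ≫ g.θε _
  θβ n := f.θβ n ≫ g.θβ _
  s_nat m := by
    have h := famMap_natural T'.α T''.α g.edge g.θα (f.s_comm m)
    simp only [Functor.map_comp, Category.assoc, Function.comp_apply]
    rw [g.s_nat, ← Category.assoc, f.s_nat]
    simp only [Category.assoc]
    rw [← Category.assoc (famMap _ _), h]
    simp
  p_nat m := by
    have h := famMap_natural T'.β T''.β g.node g.θβ (f.p_comm m)
    simp only [Functor.map_comp, Category.assoc, Function.comp_apply]
    rw [g.p_nat, ← Category.assoc, f.p_nat]
    simp only [Category.assoc]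
    rw [← Category.assoc (famMap _ _), h]
    simp
  t_nat n := by
    have h := famMap_natural T'.α T''.α g.edge g.θα (f.t_comm n)
    simp only [Functor.map_comp, Category.assoc, Function.comp_apply]
    rw [g.t_nat, ← Category.assoc, f.t_nat]
    simp only [Category.assoc]
    rw [← Category.assoc (famMap _ _), h]
    simp

end Mor

/-- The embedding underlying an isomorphism. -/
@[simps]
def Hom.toMor {T T' : PTree P} (f : Hom T T') : Mor T T' where
  edge := f.edge
  mark := f.mark
  node := f.node
  s_comm := f.s_comm
  p_comm := f.p_comm
  t_comm := f.t_comm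
  θα := f.θα
  θε := f.θε
  θβ := f.θβ
  s_nat := f.s_nat
  p_nat := f.p_nat
  t_nat := f.t_nat

namespace Mor

variable {T T' : PTree P} (φ : Mor T T')

/-- The compatibility of `φ` with the middle square, as a condition on arrows of the homotopy fibre of
`E → B` over the decoration of a node `n`. -/
theorem map_θε_comp {m : T.M} {n : T.N} {m' : T'.M} (hm : T.p m = n) (h : φ.mark m = m')
    (h' : T'.p m' = φ.node n) :
    P.p.map (φ.θε m ≫ famMap T'.ε h) ≫ T'.pIso m' ≫ famMap T'.β h' ≫ Groupoid.inv (φ.θβ n) =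
      T.pIso m ≫ famMap T.β hm := by
  subst hm h
  have := φ.p_nat m
  simp only [famMap_rfl, Category.comp_id]
  rw [← Category.assoc, this]
  simp

/-- An embedding is injective on the inputs of each node, by the uniqueness half of the cartesian
property of its source. -/
theorem mark_inj_of_p_eq {m m' : T.M} (hp : T.p m' = T.p m) (h : φ.mark m' = φ.mark m) :
    m' = m := by
  have key := ((toFibre_isEquivalence_iff _ _ _).1 (T.cartesian (T.p m)) (T'.ε (φ.mark m))
    (T'.pIso (φ.mark m) ≫ famMap T'.β (φ.p_comm m).symm ≫ Groupoid.inv (φ.θβ (T.p m)))).unique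
    (y₁ := ⟨⟨m', hp⟩, φ.θε m' ≫ famMap T'.ε h⟩)
    (y₂ := ⟨⟨m, rfl⟩, φ.θε m ≫ famMap T'.ε rfl⟩)
    (φ.map_θε_comp hp h _) (φ.map_θε_comp rfl rfl _)
  exact congrArg (fun x => x.1.1) key

/-- All inputs of a node of the image lie in the image, by the cartesian property of source and
target. -/
theorem exists_mark {n : T.N} {m' : T'.M} (h : T'.p m' = φ.node n) :
    ∃ m, T.p m = n ∧ φ.mark m = m' := by
  obtain ⟨⟨⟨m, rfl⟩, j⟩, hj, -⟩ := (toFibre_isEquivalence_iff _ _ _).1 (T.cartesian n) (T'.ε m')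
    (T'.pIso m' ≫ famMap T'.β h ≫ Groupoid.inv (φ.θβ n))
  refine ⟨m, rfl, ?_⟩
  have hj' : P.p.map j ≫ T'.pIso m' ≫ famMap T'.β h = T.pIso m ≫ φ.θβ (T.p m) := by
    have := congrArg (· ≫ φ.θβ (T.p m)) hj
    simpa using this
  have key := ((toFibre_isEquivalence_iff _ _ _).1 (T'.cartesian (φ.node (T.p m))) (T'.ε m')
    (T'.pIso m' ≫ famMap T'.β h)).unique
    (y₁ := ⟨⟨φ.mark m, (φ.p_comm m).symm⟩, Groupoid.inv (φ.θε m) ≫ j⟩) (y₂ := ⟨⟨m', h⟩, 𝟙 _⟩)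
    (by
      simp only [Functor.map_comp, Category.assoc, hj']
      have := φ.p_nat m
      have h2 : T'.pIso (φ.mark m) = P.p.map (Groupoid.inv (φ.θε m)) ≫ T.pIso m ≫
          φ.θβ (T.p m) ≫ famMap T'.β (φ.p_comm m) := by
        rw [← this, ← Category.assoc, ← Functor.map_comp]; simp
      rw [h2]; simp)
    (by simp)
  exact congrArg (fun x => x.1.1) key

theorem isAbove_edge (a : T.A) : T'.IsAbove (φ.edge T.root) (φ.edge a) := by
  induction a using T.edge_induction with
  | root => exact ⟨0, rfl⟩
  | step m ih =>
    rw [φ.s_comm]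
    apply Tree.isAbove_s
    rwa [← φ.p_comm, ← φ.t_comm]

theorem edge_s_ne (m : T.M) : φ.edge (T.s m) ≠ φ.edge T.root := by
  intro h
  have := φ.isAbove_edge (T.t (T.p m))
  rw [← h, φ.s_comm, φ.t_comm, φ.p_comm] at this
  exact T'.not_isAbove_output _ this

/-- An embedding is injective: two edges with the same image are compared by descending to the root,
where the image of an edge strictly above the root cannot be the image of the root. -/
theorem edge_injective : Function.Injective φ.edge := by
  intro a
  induction a using T.edge_induction with
  | root =>
    intro a' h
    by_contra hne
    obtain ⟨m, rfl⟩ := T.exists_s (Ne.symm hne)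
    exact φ.edge_s_ne m h.symm
  | step m ih =>
    intro a' h
    by_cases ha : a' = T.root
    · subst ha
      exact absurd h (φ.edge_s_ne m)
    · obtain ⟨m', rfl⟩ := T.exists_s ha
      rw [φ.s_comm, φ.s_comm] at h
      have h1 := T'.s_injective h
      have h2 : T.t (T.p m) = T.t (T.p m') := ih (by rw [φ.t_comm, φ.t_comm, φ.p_comm, φ.p_comm, h1])
      rw [φ.mark_inj_of_p_eq (T.t_injective h2) h1]

theorem node_injective : Function.Injective φ.node := fun n n' h =>
  T.t_injective (φ.edge_injective (by rw [φ.t_comm, φ.t_comm, h]))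

theorem mark_injective : Function.Injective φ.mark := fun m m' h =>
  T.s_injective (φ.edge_injective (by rw [φ.s_comm, φ.s_comm, h]))

/-- An embedding sends leaves to leaves. -/
def LeafPreserving : Prop := ∀ a ∉ Set.range T.t, φ.edge a ∉ Set.range T'.t

variable {φ} in
theorem edge_surjective (hr : φ.edge T.root = T'.root) (hl : φ.LeafPreserving) :
    Function.Surjective φ.edge := by
  intro a'
  induction a' using T'.edge_induction with
  | root => exact ⟨_, hr⟩
  | step m' ih =>
    obtain ⟨a, ha⟩ := ih
    obtain ⟨n, rfl⟩ : a ∈ Set.range T.t := by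
      by_contra h
      exact hl a h ⟨_, ha.symm⟩
    rw [φ.t_comm] at ha
    obtain ⟨m, -, rfl⟩ := φ.exists_mark (T'.t_injective ha).symm
    exact ⟨_, φ.s_comm m⟩

variable {φ} in
theorem node_surjective (hr : φ.edge T.root = T'.root) (hl : φ.LeafPreserving) :
    Function.Surjective φ.node := by
  intro n'
  obtain ⟨a, ha⟩ := edge_surjective hr hl (T'.t n')
  obtain ⟨n, rfl⟩ : a ∈ Set.range T.t := by
    by_contra h
    exact hl a h ⟨_, ha.symm⟩
  rw [φ.t_comm] at ha
  exact ⟨n, T'.t_injective ha⟩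

variable {φ} in
theorem mark_surjective (hr : φ.edge T.root = T'.root) (hl : φ.LeafPreserving) :
    Function.Surjective φ.mark := by
  intro m'
  obtain ⟨n, hn⟩ := node_surjective hr hl (T'.p m')
  obtain ⟨m, -, hm⟩ := φ.exists_mark hn.symm
  exact ⟨m, hm⟩

/-- An embedding which preserves the root and the leaves is an isomorphism. -/
noncomputable def toHom (hr : φ.edge T.root = T'.root) (hl : φ.LeafPreserving) : T ⟶ T' where
  edge := Equiv.ofBijective φ.edge ⟨φ.edge_injective, edge_surjective hr hl⟩
  mark := Equiv.ofBijective φ.mark ⟨φ.mark_injective, mark_surjective hr hl⟩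
  node := Equiv.ofBijective φ.node ⟨φ.node_injective, node_surjective hr hl⟩
  s_comm := φ.s_comm
  p_comm := φ.p_comm
  t_comm := φ.t_comm
  θα := φ.θα
  θε := φ.θε
  θβ := φ.θβ
  s_nat := φ.s_nat
  p_nat := φ.p_nat
  t_nat := φ.t_nat

@[simp] theorem toMor_toHom (hr : φ.edge T.root = T'.root) (hl : φ.LeafPreserving) :
    Hom.toMor (φ.toHom hr hl) = φ := rfl

end Mor

theorem Hom.leafPreserving {T T' : PTree P} (f : T ⟶ T') : (Hom.toMor f).LeafPreserving := by
  rintro a ha ⟨n, hn⟩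
  refine ha ⟨(Hom.node f).symm n, (Hom.edge f).injective ?_⟩
  rw [Hom.t_comm, Equiv.apply_symm_apply, hn]
  rfl

/-! ### Subtrees as images of embeddings -/

section Sub

variable {T : PTree P} {r : T.A} (c : Subtree T.toTree r)

/-- The inclusion of a subtree. -/
@[simps]
def incl : Mor (T.sub c) T where
  edge := Subtype.val
  mark := Subtype.val
  node := Subtype.val
  s_comm _ := rfl
  p_comm _ := rfl
  t_comm _ := rfl
  θα _ := 𝟙 _
  θε _ := 𝟙 _
  θβ _ := 𝟙 _
  s_nat m := by
    change P.s.map (𝟙 (T.ε m.1)) ≫ T.sIso m.1 = T.sIso m.1 ≫ 𝟙 _ ≫ 𝟙 _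
    simp
  p_nat m := by
    change P.p.map (𝟙 (T.ε m.1)) ≫ T.pIso m.1 = T.pIso m.1 ≫ 𝟙 _ ≫ 𝟙 _
    simp
  t_nat n := by
    change P.t.map (𝟙 (T.β n.1)) ≫ T.tIso n.1 = T.tIso n.1 ≫ 𝟙 _ ≫ 𝟙 _
    simp

variable {S : PTree P}

namespace Mor

variable {c} (φ : Mor S T)

theorem edge_mem (hr : φ.edge S.root = r) (hn : ∀ n, φ.node n ∈ c.nodes) (a : S.A) :
    φ.edge a ∈ c.edges := by
  by_cases ha : a = S.root
  · rw [ha, hr]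
    exact c.root_mem
  · obtain ⟨m, rfl⟩ := S.exists_s ha
    rw [φ.s_comm]
    refine c.input_mem _ ?_
    rw [← φ.p_comm]
    exact hn _

/-- The factorization of an embedding through a subtree containing its image. -/
def codRestrict (hr : φ.edge S.root = r) (hn : ∀ n, φ.node n ∈ c.nodes) : Mor S (T.sub c) where
  edge a := ⟨φ.edge a, φ.edge_mem hr hn a⟩
  mark m := ⟨φ.mark m, by rw [← φ.p_comm]; exact hn _⟩
  node n := ⟨φ.node n, hn n⟩
  s_comm m := Subtype.ext (φ.s_comm m)
  p_comm m := Subtype.ext (φ.p_comm m)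
  t_comm n := Subtype.ext (φ.t_comm n)
  θα := φ.θα
  θε := φ.θε
  θβ := φ.θβ
  s_nat := φ.s_nat
  p_nat := φ.p_nat
  t_nat := φ.t_nat

theorem codRestrict_comp_incl (hr : φ.edge S.root = r) (hn : ∀ n, φ.node n ∈ c.nodes) :
    (φ.codRestrict hr hn).comp (incl c) = φ :=
  ext' (fun _ => rfl) (fun _ => rfl) (fun _ => rfl)
    (fun _ => (Category.comp_id _).trans (Category.comp_id _))
    (fun _ => (Category.comp_id _).trans (Category.comp_id _))
    (fun _ => (Category.comp_id _).trans (Category.comp_id _))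

end Mor

theorem comp_incl_injective :
    Function.Injective fun k : S ⟶ T.sub c => (Hom.toMor k).comp (incl c) := by
  intro k k' h
  refine Hom.ext' (fun a => Subtype.ext (Mor.edge_congr h a))
    (fun m => Subtype.ext (Mor.mark_congr h m)) (fun n => Subtype.ext (Mor.node_congr h n))
    (fun a => ?_) (fun m => ?_) (fun n => ?_)
  · have := Mor.θα_congr h a
    simp only [Mor.comp_θα, Hom.toMor_θα, incl_θα] at this
    erw [Category.comp_id, Category.comp_id] at this
    exact this
  · have := Mor.θε_congr h m
    simp only [Mor.comp_θε, Hom.toMor_θε, incl_θε] at this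
    erw [Category.comp_id, Category.comp_id] at this
    exact this
  · have := Mor.θβ_congr h n
    simp only [Mor.comp_θβ, Hom.toMor_θβ, incl_θβ] at this
    erw [Category.comp_id, Category.comp_id] at this
    exact this

theorem range_edge_comp_incl (k : S ⟶ T.sub c) :
    Set.range ((Hom.toMor k).comp (incl c)).edge = c.edges := by
  change Set.range (Subtype.val ∘ (Hom.edge k)) = _
  exact ((Hom.edge k).surjective.range_comp _).trans Subtype.range_coe

theorem range_node_comp_incl (k : S ⟶ T.sub c) :
    Set.range ((Hom.toMor k).comp (incl c)).node = c.nodes := by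
  change Set.range (Subtype.val ∘ (Hom.node k)) = _
  exact ((Hom.node k).surjective.range_comp _).trans Subtype.range_coe

theorem comp_incl_edge_root (k : S ⟶ T.sub c) :
    ((Hom.toMor k).comp (incl c)).edge S.root = r :=
  congrArg Subtype.val (edge_root k)

/-- The image of an embedding which preserves the root. -/
def Mor.cut (φ : Mor S T) (hr : φ.edge S.root = T.root) : T.Cut where
  edges := Set.range φ.edge
  nodes := Set.range φ.node
  root_mem := ⟨_, hr⟩
  output_mem := by
    rintro _ ⟨n, rfl⟩
    exact ⟨_, φ.t_comm n⟩
  input_mem := by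
    rintro m' ⟨n, hn⟩
    obtain ⟨m, -, rfl⟩ := φ.exists_mark hn.symm
    exact ⟨_, φ.s_comm m⟩
  input_ne_root m _ := T.s_ne_root m
  exists_input := by
    rintro _ ⟨a, rfl⟩ hne
    obtain ⟨m, rfl⟩ := S.exists_s (a := a) (by rintro rfl; exact hne hr)
    exact ⟨φ.mark m, ⟨_, φ.p_comm m⟩, (φ.s_comm m).symm⟩

/-- Cuts of `T` with an isomorphism to `S` are embeddings of `S` into `T` preserving the root. -/
noncomputable def cutHomEquiv (S T : PTree P) :
    (Σ c : T.Cut, (S ⟶ T.sub c)) ≃ {φ : Mor S T // φ.edge S.root = T.root} :=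
  Equiv.ofBijective
    (fun x => ⟨(Hom.toMor x.2).comp (incl x.1), comp_incl_edge_root x.1 x.2⟩) <| by
    constructor
    · rintro ⟨c, k⟩ ⟨c', k'⟩ h
      have h := congrArg Subtype.val h
      dsimp only at h
      obtain rfl : c = c' := Subtree.ext
        (by rw [← range_edge_comp_incl c k, h, range_edge_comp_incl])
        (by rw [← range_node_comp_incl c k, h, range_node_comp_incl])
      rw [comp_incl_injective c h]
    · rintro ⟨φ, hr⟩
      have hn : ∀ n, φ.node n ∈ (φ.cut hr).nodes := fun n => ⟨n, rfl⟩
      refine ⟨⟨φ.cut hr, (φ.codRestrict hr hn).toHom (Subtype.ext hr) ?_⟩,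
        Subtype.ext (φ.codRestrict_comp_incl hr hn)⟩
      rintro a ha ⟨⟨_, n, rfl⟩, hn'⟩
      refine ha ⟨n, φ.edge_injective ?_⟩
      rw [φ.t_comm]
      exact congrArg Subtype.val hn'

/-- Isomorphisms from `S` to the ideal subtree generated by `e` are leaf-preserving embeddings of
`S` into `T` with root `e`. -/
noncomputable def idealHomEquiv (S T : PTree P) (e : T.A) :
    (S ⟶ T.sub (T.ideal e)) ≃ {φ : Mor S T // φ.edge S.root = e ∧ φ.LeafPreserving} :=
  Equiv.ofBijective
    (fun k => ⟨(Hom.toMor k).comp (incl _), comp_incl_edge_root _ k, by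
      rintro a ha ⟨n, hn⟩
      have hab : T.IsAbove e (T.t n) := by
        rw [hn]
        exact (Hom.edge k a).2
      exact Hom.leafPreserving k a ha ⟨⟨n, hab⟩, Subtype.ext hn⟩⟩) <| by
    constructor
    · intro k k' h
      exact comp_incl_injective _ (congrArg Subtype.val h)
    · rintro ⟨φ, hr, hl⟩
      have hn : ∀ n, φ.node n ∈ (T.ideal e).nodes := fun n => by
        have := φ.isAbove_edge (S.t n)
        rw [hr, φ.t_comm] at this
        exact this
      refine ⟨(φ.codRestrict hr hn).toHom (Subtype.ext hr) ?_,
        Subtype.ext (φ.codRestrict_comp_incl hr hn)⟩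
      rintro a ha ⟨n, hn'⟩
      exact hl a ha ⟨n.1, congrArg Subtype.val hn'⟩

end Sub

end PTree

/-! ### Grafting -/

namespace Tree

variable (S : Tree) (F : S.Leaf → Tree)

/-- The edges of the tree obtained by grafting the trees `F l` onto the leaves `l` of `S`: the root
edge of `F l` is identified with the leaf `l`. -/
abbrev GraftEdge : Type := S.A ⊕ Σ l : S.Leaf, {a : (F l).A // a ≠ (F l).root}

open Classical in
/-- The edge of the grafted tree given by an edge of one of the trees `F l`. -/
noncomputable def graftEdge (x : Σ l : S.Leaf, (F l).A) : GraftEdge S F :=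
  if h : x.2 = (F x.1).root then Sum.inl x.1.1 else Sum.inr ⟨x.1, x.2, h⟩

variable {S F}

@[simp] theorem graftEdge_root (l : S.Leaf) : graftEdge S F ⟨l, (F l).root⟩ = Sum.inl l.1 :=
  dif_pos rfl

theorem graftEdge_of_ne {l : S.Leaf} {a : (F l).A} (h : a ≠ (F l).root) :
    graftEdge S F ⟨l, a⟩ = Sum.inr ⟨l, a, h⟩ := dif_neg h

theorem graftEdge_injective : Function.Injective (graftEdge S F) := by
  rintro ⟨l, a⟩ ⟨l', a'⟩ h
  by_cases ha : a = (F l).root <;> by_cases ha' : a' = (F l').root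
  · subst ha ha'
    rw [graftEdge_root, graftEdge_root] at h
    obtain rfl : l = l' := Subtype.ext (Sum.inl_injective h)
    rfl
  · subst ha
    rw [graftEdge_root, graftEdge_of_ne ha'] at h
    cases h
  · subst ha'
    rw [graftEdge_root, graftEdge_of_ne ha] at h
    cases h
  · rw [graftEdge_of_ne ha, graftEdge_of_ne ha'] at h
    cases h
    rfl

variable (S F)

theorem graft_s_injective : Function.Injective (Sum.map S.s fun x : Σ l, (F l).M =>
    (⟨x.1, (F x.1).s x.2, (F x.1).s_ne_root x.2⟩ : Σ l, {a : (F l).A // a ≠ (F l).root})) := by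
  rintro (m | ⟨l, m⟩) (m' | ⟨l', m'⟩) h
  · exact congrArg Sum.inl (S.s_injective (Sum.inl_injective h))
  · cases h
  · cases h
  · have h' : (⟨l, (F l).s m⟩ : Σ l, (F l).A) = ⟨l', (F l').s m'⟩ :=
      congrArg (fun x : Σ l, {a : (F l).A // a ≠ (F l).root} => (⟨x.1, x.2.1⟩ : Σ l, (F l).A))
        (Sum.inr_injective h)
    obtain rfl : l = l' := congrArg Sigma.fst h'
    obtain rfl : m = m' := (F l).s_injective (eq_of_heq (Sigma.mk.inj h').2)
    rfl

/-- The tree obtained by grafting the trees `F l` onto the leaves `l` of `S`. -/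
noncomputable def graft : Tree where
  A := GraftEdge S F
  M := S.M ⊕ Σ l, (F l).M
  N := S.N ⊕ Σ l, (F l).N
  s := Sum.map S.s fun x => ⟨x.1, (F x.1).s x.2, (F x.1).s_ne_root x.2⟩
  p := Sum.map S.p fun x => ⟨x.1, (F x.1).p x.2⟩
  t := Sum.elim (fun n => Sum.inl (S.t n)) fun x => graftEdge S F ⟨x.1, (F x.1).t x.2⟩
  root := Sum.inl S.root
  t_injective := by
    have key : ∀ n l n', Sum.inl (S.t n) ≠ graftEdge S F ⟨l, (F l).t n'⟩ := by
      intro n l n' h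
      by_cases hr : (F l).t n' = (F l).root
      · rw [hr, graftEdge_root] at h
        exact l.2 ⟨n, Sum.inl_injective h⟩
      · rw [graftEdge_of_ne hr] at h
        cases h
    rintro (n | ⟨l, n⟩) (n' | ⟨l', n'⟩) h
    · exact congrArg Sum.inl (S.t_injective (Sum.inl_injective h))
    · exact absurd h (key _ _ _)
    · exact absurd h.symm (key _ _ _)
    · have h' : (⟨l, (F l).t n⟩ : Σ l, (F l).A) = ⟨l', (F l').t n'⟩ := graftEdge_injective h
      obtain rfl : l = l' := congrArg Sigma.fst h'
      obtain rfl : n = n' := (F l).t_injective (eq_of_heq (Sigma.mk.inj h').2)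
      rfl
  s_injective := graft_s_injective S F
  compl_range_s := by
    ext a
    rw [Set.mem_compl_iff, Set.mem_singleton_iff, ← not_iff_not, not_not]
    constructor
    · rintro ⟨m | ⟨l, m⟩, rfl⟩ h
      · exact S.s_ne_root m (Sum.inl_injective h)
      · cases h
    · intro h
      rcases a with a | ⟨l, a, ha⟩
      · obtain ⟨m, rfl⟩ := S.exists_s (a := a) (by rintro rfl; exact h rfl)
        exact ⟨Sum.inl m, rfl⟩
      · obtain ⟨m, rfl⟩ := (F l).exists_s ha
        exact ⟨Sum.inr ⟨l, m⟩, rfl⟩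
  walk_root := by
    set s : (S.M ⊕ Σ l, (F l).M) → GraftEdge S F :=
      Sum.map S.s fun x => ⟨x.1, (F x.1).s x.2, (F x.1).s_ne_root x.2⟩
    set p : (S.M ⊕ Σ l, (F l).M) → S.N ⊕ Σ l, (F l).N := Sum.map S.p fun x => ⟨x.1, (F x.1).p x.2⟩
    set t : (S.N ⊕ Σ l, (F l).N) → GraftEdge S F :=
      Sum.elim (fun n => Sum.inl (S.t n)) fun x => graftEdge S F ⟨x.1, (F x.1).t x.2⟩
    have s_inj : Function.Injective s := graft_s_injective S F
    have step : ∀ m, (∃ k : ℕ, (walk s p t)^[k] (t (p m)) = Sum.inl S.root) →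
        ∃ k : ℕ, (walk s p t)^[k] (s m) = Sum.inl S.root := by
      rintro m ⟨k, hk⟩
      exact ⟨k + 1, by rw [Function.iterate_succ_apply, walk_s s_inj, hk]⟩
    have hS : ∀ a, ∃ k : ℕ, (walk s p t)^[k] (Sum.inl a) = Sum.inl S.root := by
      intro a
      induction a using S.edge_induction with
      | root => exact ⟨0, rfl⟩
      | step m ih => exact step (Sum.inl m) ih
    have hF : ∀ l a, ∃ k : ℕ, (walk s p t)^[k] (graftEdge S F ⟨l, a⟩) = Sum.inl S.root := by
      intro l a
      induction a using (F l).edge_induction with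
      | root =>
        rw [graftEdge_root]
        exact hS _
      | step m ih =>
        rw [graftEdge_of_ne ((F l).s_ne_root m)]
        exact step (Sum.inr ⟨l, m⟩) ih
    rintro (a | ⟨l, a, ha⟩)
    · exact hS a
    · rw [← graftEdge_of_ne ha]
      exact hF l a

/-- The leaves of the grafted tree are the leaves of the trees `F l`. -/
theorem exists_leaf_of_graft_leaf {a : (graft S F).A} (h : a ∉ Set.range (graft S F).t) :
    ∃ l, ∃ b ∉ Set.range (F l).t, graftEdge S F ⟨l, b⟩ = a := by
  have key : ∀ l b, graftEdge S F ⟨l, b⟩ = a → b ∉ Set.range (F l).t := by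
    rintro l _ rfl ⟨n, rfl⟩
    exact h ⟨Sum.inr ⟨l, n⟩, rfl⟩
  rcases a with a | ⟨l, a, ha⟩
  · have hl : a ∉ Set.range S.t := by
      rintro ⟨n, rfl⟩
      exact h ⟨Sum.inl n, rfl⟩
    exact ⟨⟨a, hl⟩, _, key _ _ (graftEdge_root ⟨a, hl⟩), graftEdge_root ⟨a, hl⟩⟩
  · exact ⟨l, a, key _ _ (graftEdge_of_ne ha), graftEdge_of_ne ha⟩

end Tree

namespace PTree

open FaaDiBruno.Tree (graftEdge graftEdge_root graftEdge_of_ne)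

variable (S : PTree P) (F : S.Leaf → PTree P)

/-! The next lemmas are about arbitrary families, so that they apply to the colours of a grafted tree,
whose types agree only after unfolding of definitions. -/

section famMap

variable {X Y : Type*} {C : Type*} [Groupoid C] (f : X → C) (g : Y → C) (u : X → Y)
  (θ : ∀ x, f x ⟶ g (u x))

theorem comp_famMap_cancel {x y : X} (e : x = y) (e' : y = x) {w : C} (k : w ⟶ f x) (j : f x ⟶ f y)
    (hj : j = famMap f e) : k ≫ j ≫ famMap f e' = k := by
  subst e hj; simp

theorem comp_famMap_comp_natural {x y : X} (e : x = y) {w : C} {z : Y} (c : w ⟶ g z) (e₁ : z = u x)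
    (e₂ : u y = z) (j : w ⟶ f y)
    (hj : j = (c ≫ famMap g e₁ ≫ Groupoid.inv (θ x)) ≫ famMap f e) :
    j ≫ θ y ≫ famMap g e₂ = c := by
  subst e e₁ hj; simp

theorem comp_natural_famMap_inv {x y : X} (e : x = y) {w : C} (k : w ⟶ f x) (e₁ : u y = u x)
    (j : w ⟶ f y) (hj : j = k ≫ famMap f e) :
    (j ≫ θ y) ≫ famMap g e₁ ≫ Groupoid.inv (𝟙 (f x) ≫ θ x) = k := by
  subst e hj; simp

theorem eq_of_comp_comp_eq {w x y z : C} (c : w ⟶ x) (a : x ⟶ y) (b : y ⟶ z) (d : x ⟶ z)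
    (h : (c ≫ a) ≫ b = c ≫ d) : a ≫ b = d := by
  rwa [Category.assoc, cancel_epi] at h

end famMap

/-- The data for grafting the `P`-trees `F l` onto the leaves `l` of `S`: an isomorphism from the
colour of the root of `F l` to the colour of `l`, for each `l`. -/
abbrev Gluing : Type _ := ∀ l : S.Leaf, ((F l).α (F l).root ⟶ S.α l.1)

/-- The colours of the edges of the grafted tree. -/
def graftα : S.toTree.GraftEdge (fun l => (F l).toTree) → I :=
  Sum.elim S.α fun x => (F x.1).α x.2.1

variable {S F}

open Classical in
/-- The comparison of the colour of an edge of `F l` with its colour in the grafted tree. -/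
noncomputable def graftIso (h : Gluing S F) (l : S.Leaf) (a : (F l).A) :
    (F l).α a ⟶ graftα S F (graftEdge S.toTree (fun l => (F l).toTree) ⟨l, a⟩) :=
  if ha : a = (F l).root then
    famMap (F l).α ha ≫ h l ≫ famMap (graftα S F)
      ((congrArg (fun b => graftEdge S.toTree (fun l => (F l).toTree) ⟨l, b⟩) ha).trans
        (graftEdge_root (F := fun l => (F l).toTree) l)).symm
  else famMap (graftα S F) (graftEdge_of_ne (F := fun l => (F l).toTree) ha).symm

theorem graftIso_root (h : Gluing S F) (l : S.Leaf) :
    graftIso h l (F l).root = h l ≫ famMap (graftα S F)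
      (graftEdge_root (F := fun l => (F l).toTree) l).symm :=
  (dif_pos rfl).trans (Category.id_comp _)

theorem graftIso_of_ne (h : Gluing S F) (l : S.Leaf) {a : (F l).A} (ha : a ≠ (F l).root) :
    graftIso h l a = famMap (graftα S F)
      (graftEdge_of_ne (F := fun l => (F l).toTree) ha).symm :=
  dif_neg ha

/-- The `P`-tree obtained by grafting the trees `F l` onto the leaves `l` of `S`. -/
noncomputable def graft (h : Gluing S F) : PTree P where
  toTree := S.toTree.graft fun l => (F l).toTree
  α := graftα S F
  ε := Sum.elim S.ε fun x => (F x.1).ε x.2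
  β := Sum.elim S.β fun x => (F x.1).β x.2
  sIso
    | Sum.inl m => S.sIso m
    | Sum.inr ⟨l, m⟩ => (F l).sIso m
  pIso
    | Sum.inl m => S.pIso m
    | Sum.inr ⟨l, m⟩ => (F l).pIso m
  tIso
    | Sum.inl n => S.tIso n
    | Sum.inr ⟨l, n⟩ => (F l).tIso n ≫ graftIso h l ((F l).t n)
  cartesian := by
    rintro (n | ⟨l, n⟩)
    · rw [toFibre_isEquivalence_iff]
      intro e f
      obtain ⟨⟨⟨m, rfl⟩, j⟩, hj, huniq⟩ := (toFibre_isEquivalence_iff _ _ _).1 (S.cartesian n) e f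
      refine ⟨⟨⟨Sum.inl m, rfl⟩, j⟩, hj, ?_⟩
      rintro ⟨⟨m' | ⟨l', m'⟩, hm'⟩, j'⟩ hj'
      · have hp : S.p m' = S.p m := Sum.inl_injective hm'
        have := huniq ⟨⟨m', hp⟩, j'⟩ hj'
        have hmm : m' = m := congrArg (fun x => x.1.1) this
        subst hmm
        have hjj : j' = j := eq_of_heq (Sigma.mk.inj this).2
        subst hjj
        rfl
      · cases hm'
    · rw [toFibre_isEquivalence_iff]
      intro e f
      obtain ⟨⟨⟨m, rfl⟩, j⟩, hj, huniq⟩ :=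
        (toFibre_isEquivalence_iff _ _ _).1 ((F l).cartesian n) e f
      refine ⟨⟨⟨Sum.inr ⟨l, m⟩, rfl⟩, j⟩, hj, ?_⟩
      rintro ⟨⟨m' | ⟨l', m'⟩, hm'⟩, j'⟩ hj'
      · cases hm'
      · obtain ⟨rfl, hp⟩ := Sigma.mk.inj (Sum.inr_injective hm')
        have := huniq ⟨⟨m', eq_of_heq hp⟩, j'⟩ hj'
        have hmm : m' = m := congrArg (fun x => x.1.1) this
        subst hmm
        have hjj : j' = j := eq_of_heq (Sigma.mk.inj this).2
        subst hjj
        rfl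

/-- The embedding of `S` into the grafted tree. -/
noncomputable def graftInl (h : Gluing S F) : Mor S (graft h) where
  edge a := Sum.inl a
  mark m := Sum.inl m
  node n := Sum.inl n
  s_comm _ := rfl
  p_comm _ := rfl
  t_comm _ := rfl
  θα a := 𝟙 (S.α a)
  θε m := 𝟙 (S.ε m)
  θβ n := 𝟙 (S.β n)
  s_nat m := by
    change P.s.map (𝟙 (S.ε m)) ≫ S.sIso m = S.sIso m ≫ 𝟙 _ ≫ 𝟙 _
    simp
  p_nat m := by
    change P.p.map (𝟙 (S.ε m)) ≫ S.pIso m = S.pIso m ≫ 𝟙 _ ≫ 𝟙 _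
    simp
  t_nat n := by
    change P.t.map (𝟙 (S.β n)) ≫ S.tIso n = S.tIso n ≫ 𝟙 _ ≫ 𝟙 _
    simp

/-- The embedding of `F l` into the grafted tree. -/
noncomputable def graftInr (h : Gluing S F) (l : S.Leaf) : Mor (F l) (graft h) where
  edge a := graftEdge S.toTree (fun l => (F l).toTree) ⟨l, a⟩
  mark m := Sum.inr ⟨l, m⟩
  node n := Sum.inr ⟨l, n⟩
  s_comm m := graftEdge_of_ne ((F l).s_ne_root m)
  p_comm _ := rfl
  t_comm _ := rfl
  θα a := graftIso h l a
  θε m := 𝟙 ((F l).ε m)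
  θβ n := 𝟙 ((F l).β n)
  s_nat m := by
    have h1 : P.s.map (𝟙 ((F l).ε m)) ≫ (F l).sIso m = (F l).sIso m := by simp
    exact h1.trans (comp_famMap_cancel (graftα S F)
      (x := Sum.inr ⟨l, _, (F l).s_ne_root m⟩) _ _ ((F l).sIso m) _
      (graftIso_of_ne h l ((F l).s_ne_root m))).symm
  p_nat m := by
    change P.p.map (𝟙 ((F l).ε m)) ≫ (F l).pIso m = (F l).pIso m ≫ 𝟙 _ ≫ 𝟙 _
    simp
  t_nat n := by
    change P.t.map (𝟙 ((F l).β n)) ≫ (F l).tIso n ≫ graftIso h l ((F l).t n) =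
      (F l).tIso n ≫ graftIso h l ((F l).t n) ≫ 𝟙 _
    simp

theorem graftInr_edge_root (h : Gluing S F) (l : S.Leaf) :
    (graftInr h l).edge (F l).root = (graftInl h).edge l.1 :=
  graftEdge_root (F := fun l => (F l).toTree) l

theorem graftInr_leafPreserving (h : Gluing S F) (l : S.Leaf) :
    (graftInr h l).LeafPreserving := by
  rintro a ha ⟨n | ⟨l', n⟩, hn⟩
  · by_cases har : a = (F l).root
    · subst har
      rw [graftInr_edge_root] at hn
      exact l.2 ⟨n, Sum.inl_injective hn⟩
    · exact nomatch hn.trans (graftEdge_of_ne (F := fun l => (F l).toTree) har)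
  · have h' : (⟨l', (F l').t n⟩ : Σ l, (F l).A) = ⟨l, a⟩ :=
      Tree.graftEdge_injective (F := fun l => (F l).toTree) hn
    obtain rfl : l' = l := congrArg Sigma.fst h'
    exact ha ⟨n, eq_of_heq (Sigma.mk.inj h').2⟩

/-- A decomposition of `T` into the trunk `S` and the crowns `F l`, up to isomorphism: an embedding
of `S` into `T` preserving the root, and, for each leaf `l` of `S`, an embedding of `F l` onto the
ideal subtree of `T` generated by `l`. -/
@[ext]
structure Decomp (S : PTree P) (F : S.Leaf → PTree P) (T : PTree P) where
  trunk : Mor S T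
  crown : ∀ l, Mor (F l) T
  trunk_root : trunk.edge S.root = T.root
  crown_root : ∀ l, (crown l).edge (F l).root = trunk.edge l.1
  crown_leaf : ∀ l, (crown l).LeafPreserving

namespace Decomp

variable {T : PTree P}

/-- The gluing datum recovered from a decomposition. -/
def gluing (D : Decomp S F T) : Gluing S F := fun l =>
  (D.crown l).θα (F l).root ≫ famMap T.α (D.crown_root l) ≫ Groupoid.inv (D.trunk.θα l.1)

/-- The decomposition of `T` transported from a grafted tree isomorphic to `T`. -/
noncomputable def ofHom (h : Gluing S F) (k : graft h ⟶ T) : Decomp S F T where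
  trunk := (graftInl h).comp (Hom.toMor k)
  crown l := (graftInr h l).comp (Hom.toMor k)
  trunk_root := edge_root k
  crown_root l := congrArg (Hom.edge k) (graftInr_edge_root h l)
  crown_leaf l a ha := Hom.leafPreserving k _ (graftInr_leafPreserving h l a ha)

/-- Every gluing datum arises, and isomorphisms preserve it. -/
theorem gluing_ofHom (h : Gluing S F) (k : graft h ⟶ T) : (ofHom h k).gluing = h := by
  funext l
  exact comp_natural_famMap_inv (graftα S F) T.α (Hom.edge k) (Hom.θα k) _ _ _ _
    (graftIso_root h l)

/-- The map on edges of the morphism out of a grafted tree given by a decomposition. -/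
def descEdge (D : Decomp S F T) :
    S.toTree.GraftEdge (fun l => (F l).toTree) → T.A :=
  Sum.elim D.trunk.edge fun x => (D.crown x.1).edge x.2.1

theorem descEdge_graftEdge (D : Decomp S F T) (l : S.Leaf) (a : (F l).A) :
    D.descEdge (graftEdge S.toTree (fun l => (F l).toTree) ⟨l, a⟩) = (D.crown l).edge a := by
  by_cases ha : a = (F l).root
  · subst ha
    rw [graftEdge_root, D.crown_root]
    rfl
  · rw [graftEdge_of_ne ha]
    rfl

/-- The 2-cell on edges of the morphism out of a grafted tree given by a decomposition. -/
def descα (D : Decomp S F T) : ∀ a, graftα S F a ⟶ T.α (D.descEdge a)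
  | Sum.inl a => D.trunk.θα a
  | Sum.inr ⟨l, a⟩ => (D.crown l).θα a.1

theorem graftIso_comp_descα (D : Decomp S F T) (l : S.Leaf) (a : (F l).A) :
    graftIso D.gluing l a ≫ D.descα (graftEdge S.toTree (fun l => (F l).toTree) ⟨l, a⟩) ≫
      famMap T.α (D.descEdge_graftEdge l a) = (D.crown l).θα a := by
  by_cases ha : a = (F l).root
  · subst ha
    exact comp_famMap_comp_natural (graftα S F) T.α D.descEdge D.descα
      (x := Sum.inl l.1) _ ((D.crown l).θα (F l).root) (D.crown_root l) _ _
      (graftIso_root D.gluing l)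
  · refine comp_famMap_comp_natural (graftα S F) T.α D.descEdge D.descα
      (x := Sum.inr ⟨l, a, ha⟩)
      (graftEdge_of_ne (F := fun l => (F l).toTree) ha).symm ((D.crown l).θα a) rfl _ _
      ((graftIso_of_ne D.gluing l ha).trans ?_)
    have h1 : (D.crown l).θα a ≫ 𝟙 _ ≫ Groupoid.inv ((D.crown l).θα a) = 𝟙 _ := by simp
    exact (Category.id_comp _).symm.trans
      (congrArg (· ≫ famMap (graftα S F) (graftEdge_of_ne (F := fun l => (F l).toTree) ha).symm)
        h1.symm)

/-- The morphism out of a grafted tree given by a decomposition. -/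
def desc (D : Decomp S F T) : Mor (graft D.gluing) T where
  edge := D.descEdge
  mark := Sum.elim D.trunk.mark fun x => (D.crown x.1).mark x.2
  node := Sum.elim D.trunk.node fun x => (D.crown x.1).node x.2
  s_comm
    | Sum.inl m => D.trunk.s_comm m
    | Sum.inr ⟨l, m⟩ => (D.crown l).s_comm m
  p_comm
    | Sum.inl m => D.trunk.p_comm m
    | Sum.inr ⟨l, m⟩ => (D.crown l).p_comm m
  t_comm
    | Sum.inl n => D.trunk.t_comm n
    | Sum.inr ⟨l, n⟩ => (D.descEdge_graftEdge l _).trans ((D.crown l).t_comm n)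
  θα := D.descα
  θε
    | Sum.inl m => D.trunk.θε m
    | Sum.inr ⟨l, m⟩ => (D.crown l).θε m
  θβ
    | Sum.inl n => D.trunk.θβ n
    | Sum.inr ⟨l, n⟩ => (D.crown l).θβ n
  s_nat
    | Sum.inl m => D.trunk.s_nat m
    | Sum.inr ⟨l, m⟩ => (D.crown l).s_nat m
  p_nat
    | Sum.inl m => D.trunk.p_nat m
    | Sum.inr ⟨l, m⟩ => (D.crown l).p_nat m
  t_nat
    | Sum.inl n => D.trunk.t_nat n
    | Sum.inr ⟨l, n⟩ => by
      have h1 := (D.crown l).t_nat n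
      have h2 := D.graftIso_comp_descα l ((F l).t n)
      rw [← h2] at h1
      refine h1.trans ?_
      change _ = ((F l).tIso n ≫ graftIso D.gluing l ((F l).t n)) ≫
        D.descα (graftEdge S.toTree (fun l => (F l).toTree) ⟨l, (F l).t n⟩) ≫ famMap T.α _
      simp only [Category.assoc, famMap_trans]

theorem desc_leafPreserving (D : Decomp S F T) : D.desc.LeafPreserving := by
  intro a ha
  obtain ⟨l, b, hb, rfl⟩ := Tree.exists_leaf_of_graft_leaf S.toTree (fun l => (F l).toTree) ha
  change D.descEdge _ ∉ _
  rw [descEdge_graftEdge]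
  exact D.crown_leaf l b hb

/-- The isomorphism from a grafted tree given by a decomposition. -/
noncomputable def toHom (D : Decomp S F T) : graft D.gluing ⟶ T :=
  D.desc.toHom D.trunk_root D.desc_leafPreserving

theorem ofHom_toHom (D : Decomp S F T) : ofHom D.gluing D.toHom = D := by
  refine Decomp.ext (Mor.ext' (fun _ => rfl) (fun _ => rfl) (fun _ => rfl) (fun a => ?_)
    (fun m => ?_) (fun n => ?_)) (funext fun l => Mor.ext' (D.descEdge_graftEdge l) (fun _ => rfl)
      (fun _ => rfl) (fun a => ?_) (fun m => ?_) (fun n => ?_))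
  · change (𝟙 (S.α a) ≫ D.trunk.θα a) ≫ 𝟙 _ = D.trunk.θα a
    simp
  · change (𝟙 (S.ε m) ≫ D.trunk.θε m) ≫ 𝟙 _ = D.trunk.θε m
    simp
  · change (𝟙 (S.β n) ≫ D.trunk.θβ n) ≫ 𝟙 _ = D.trunk.θβ n
    simp
  · exact (Category.assoc _ _ _).trans (D.graftIso_comp_descα l a)
  · change (𝟙 ((F l).ε m) ≫ (D.crown l).θε m) ≫ 𝟙 _ = (D.crown l).θε m
    simp
  · change (𝟙 ((F l).β n) ≫ (D.crown l).θβ n) ≫ 𝟙 _ = (D.crown l).θβ n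
    simp

/-- A morphism out of a grafted tree is determined on the trunk and on the trees grafted onto it, as
these cover the grafted tree. -/
theorem ofHom_injective (h : Gluing S F) :
    Function.Injective (ofHom h : (graft h ⟶ T) → Decomp S F T) := by
  intro k k' hk
  have h1 : (graftInl h).comp (Hom.toMor k) = (graftInl h).comp (Hom.toMor k') :=
    congrArg trunk hk
  have h2 : ∀ l, (graftInr h l).comp (Hom.toMor k) = (graftInr h l).comp (Hom.toMor k') :=
    fun l => congrFun (congrArg crown hk) l
  have key : ∀ a, ∃ e : Hom.edge k a = Hom.edge k' a,
      Hom.θα k a ≫ famMap T.α e = Hom.θα k' a := by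
    have hF : ∀ l a, ∃ e : Hom.edge k ((graftInr h l).edge a) = Hom.edge k' ((graftInr h l).edge a),
        Hom.θα k _ ≫ famMap T.α e = Hom.θα k' _ := fun l a => by
      refine ⟨Mor.edge_congr (h2 l) a, ?_⟩
      exact eq_of_comp_comp_eq _ _ _ _ (Mor.θα_congr (h2 l) a)
    rintro (a | ⟨l, a, ha⟩)
    · refine ⟨Mor.edge_congr h1 a, ?_⟩
      exact eq_of_comp_comp_eq _ _ _ _ (Mor.θα_congr h1 a)
    · have := hF l a
      rwa [show (graftInr h l).edge a = Sum.inr ⟨l, a, ha⟩ from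
        graftEdge_of_ne (F := fun l => (F l).toTree) ha] at this
  refine Hom.ext' (fun a => (key a).1) ?_ ?_ (fun a => (key a).2) ?_ ?_
  · rintro (m | ⟨l, m⟩)
    · exact Mor.mark_congr h1 m
    · exact Mor.mark_congr (h2 l) m
  · rintro (n | ⟨l, n⟩)
    · exact Mor.node_congr h1 n
    · exact Mor.node_congr (h2 l) n
  · rintro (m | ⟨l, m⟩)
    · exact eq_of_comp_comp_eq _ _ _ _ (Mor.θε_congr h1 m)
    · exact eq_of_comp_comp_eq _ _ _ _ (Mor.θε_congr (h2 l) m)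
  · rintro (n | ⟨l, n⟩)
    · exact eq_of_comp_comp_eq _ _ _ _ (Mor.θβ_congr h1 n)
    · exact eq_of_comp_comp_eq _ _ _ _ (Mor.θβ_congr (h2 l) n)

/-- Grafting is universal: decomposing `T` is the same as giving an isomorphism to `T` from a
grafted tree. -/
noncomputable def equiv (S : PTree P) (F : S.Leaf → PTree P) (T : PTree P) :
    (Σ h : Gluing S F, (graft h ⟶ T)) ≃ Decomp S F T :=
  Equiv.ofBijective (fun x => ofHom x.1 x.2) <| by
    constructor
    · rintro ⟨h, k⟩ ⟨h', k'⟩ e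
      dsimp only at e
      obtain rfl : h = h' := by rw [← gluing_ofHom h k, e, gluing_ofHom]
      rw [ofHom_injective h e]
    · intro D
      exact ⟨⟨D.gluing, D.toHom⟩, D.ofHom_toHom⟩

end Decomp

end PTree

/-! ### Counting isomorphisms -/

section Counting

variable {C : Type*}

theorem cls_eq_iff [Category C] {X Y : C} : cls X = cls Y ↔ Nonempty (X ≅ Y) :=
  Quotient.eq (r := isIsomorphicSetoid C)

theorem cls_eq_iff_hom [Groupoid C] {X Y : C} : cls X = cls Y ↔ Nonempty (X ⟶ Y) :=
  cls_eq_iff.trans (Groupoid.isoEquivHom X Y).nonempty_congr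

theorem cls_out [Category C] (x : Pi0 C) : cls x.out = x := Quotient.out_eq x

theorem card_aut_congr [Category C] {X Y : C} (h : cls X = cls Y) :
    Nat.card (Aut X) = Nat.card (Aut Y) := by
  obtain ⟨e⟩ := cls_eq_iff.1 h
  exact Nat.card_congr (e.conjAut).toEquiv

open Classical in
theorem card_iso [Category C] (X Y : C) :
    Nat.card (X ≅ Y) = if cls X = cls Y then Nat.card (Aut Y) else 0 := by
  split_ifs with h
  · obtain ⟨e⟩ := cls_eq_iff.1 h
    exact Nat.card_congr ⟨fun f => e.symm ≪≫ f, fun f => e ≪≫ f, fun f => by simp,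
      fun f => by ext; exact e.inv_hom_id_assoc _⟩
  · have : IsEmpty (X ≅ Y) := ⟨fun e => h (cls_eq_iff.2 ⟨e⟩)⟩
    exact Nat.card_of_isEmpty

open Classical in
theorem card_hom [Groupoid C] (X Y : C) :
    Nat.card (X ⟶ Y) = if cls X = cls Y then Nat.card (Aut Y) else 0 := by
  rw [← card_iso, Nat.card_congr (Groupoid.isoEquivHom X Y)]

theorem finite_hom [Groupoid C] (X Y : C) [Finite (Aut Y)] : Finite (X ⟶ Y) := by
  rcases isEmpty_or_nonempty (X ⟶ Y) with h | ⟨⟨e⟩⟩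
  · infer_instance
  · refine Finite.of_injective (β := Aut Y)
      (fun f => Groupoid.isoEquivHom Y Y |>.symm (Groupoid.inv e ≫ f)) fun f f' h => ?_
    exact (cancel_epi _).1 ((Groupoid.isoEquivHom Y Y).symm.injective h)

theorem card_aut_ne_zero [Category C] (X : C) [Finite (Aut X)] : (Nat.card (Aut X) : ℚ) ≠ 0 :=
  Nat.cast_ne_zero.2 Nat.card_pos.ne'

/-- The sizes of the fibres of a map from a finite set add up to the size of the set. -/
theorem finsum_card_fibre {H K : Type*} [Finite H] (q : H → K) :
    (fun x => (Nat.card {h // q h = x} : ℚ)).HasFiniteSupport ∧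
      ∑ᶠ x, (Nat.card {h // q h = x} : ℚ) = Nat.card H := by
  classical
  have := Fintype.ofFinite H
  have hs : (Function.support fun x => (Nat.card {h // q h = x} : ℚ)) ⊆
      ↑(Finset.univ.image q) := by
    intro x hx
    have hx : Nat.card {h // q h = x} ≠ 0 := Nat.cast_ne_zero.1 hx
    obtain ⟨⟨h, rfl⟩⟩ := (Nat.card_ne_zero.1 hx).1
    simp
  refine ⟨(Finset.finite_toSet _).subset hs, ?_⟩
  rw [finsum_eq_sum_of_support_subset _ hs, Nat.card_eq_fintype_card, ← Finset.card_univ,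
    Finset.card_eq_sum_card_image q, Nat.cast_sum]
  refine Finset.sum_congr rfl fun x _ => ?_
  rw [Nat.card_eq_fintype_card, Fintype.card_subtype]

/-- Orbit-stabilizer for a morphism of groupoids `R : C ⥤ D`: each object `x` of the homotopy fibre
of `R` over `v` which lies over `Z` accounts for `|Aut Z| / |Aut x|` of the arrows `R Z ⟶ v`. -/
theorem card_costructuredArrow {C D : Type*} [Groupoid C] [Groupoid D] (R : C ⥤ D) (Z : C) (v : D)
    [Finite (R.obj Z ⟶ v)] (x : CostructuredArrow R v) [Finite (Aut x)] :
    Nat.card {ψ : R.obj Z ⟶ v // cls (CostructuredArrow.mk ψ) = cls x} * Nat.card (Aut x) =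
      Nat.card (Z ⟶ x.left) := by
  classical
  have := Fintype.ofFinite (R.obj Z ⟶ v)
  -- an arrow `k` out of `Z` is an isomorphism to `x` from exactly one object over `Z`
  let e : (Σ ψ : R.obj Z ⟶ v, (CostructuredArrow.mk ψ ≅ x)) ≃ (Z ⟶ x.left) :=
    { toFun y := y.2.hom.left
      invFun k := ⟨R.map k ≫ x.hom, CostructuredArrow.isoMk
        ((Groupoid.isoEquivHom Z x.left).symm k) rfl⟩
      left_inv := by
        rintro ⟨ψ, i⟩
        have aux : ∀ (ψ' : R.obj Z ⟶ v) (j : CostructuredArrow.mk ψ' ≅ x), ψ' = ψ →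
            j.hom.left = i.hom.left →
            (⟨ψ', j⟩ : Σ ψ : R.obj Z ⟶ v, (CostructuredArrow.mk ψ ≅ x)) = ⟨ψ, i⟩ := by
          rintro _ j rfl hj
          congr 1
          ext
          exact hj
        exact aux _ _ (CostructuredArrow.w i.hom) rfl
      right_inv k := rfl }
  have (ψ : R.obj Z ⟶ v) : Finite (CostructuredArrow.mk ψ ≅ x) := by
    rcases isEmpty_or_nonempty (CostructuredArrow.mk ψ ≅ x) with h | ⟨⟨e⟩⟩
    · infer_instance
    · exact Finite.of_injective (β := Aut x) (fun f => e.symm ≪≫ f) fun f f' h => by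
        simpa using congrArg (e ≪≫ ·) h
  rw [← Nat.card_congr e, Nat.card_sigma]
  simp only [card_iso]
  rw [← Finset.sum_filter, Finset.sum_const, smul_eq_mul, Nat.card_eq_fintype_card,
    Fintype.card_subtype]

end Counting

/-- The labellings of the elements of `ι` whose multiset of labels is `m`. -/
noncomputable def labellings (ι : Type*) {κ : Type*} [Fintype ι] (m : κ →₀ ℕ) : Finset (ι → κ) :=
  Set.Finite.toFinset (s := {f : ι → κ | ∑ i, Finsupp.single (f i) 1 = m}) <| by
    refine (Set.Finite.pi' fun _ => m.support.finite_toSet).subset fun f hf i => ?_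
    rw [Finset.mem_coe, Finsupp.mem_support_iff, ← (show _ = m from hf), Finsupp.finsetSum_apply]
    refine (Finset.sum_pos' (fun _ _ => Nat.zero_le _) ⟨i, Finset.mem_univ _, ?_⟩).ne'
    simp

theorem mem_labellings {ι κ : Type*} [Fintype ι] {m : κ →₀ ℕ} {f : ι → κ} :
    f ∈ labellings ι m ↔ ∑ i, Finsupp.single (f i) 1 = m := by
  simp [labellings]

/-! ### Counting cuts -/

namespace PTree

/-- The bijection on leaves induced by an isomorphism. -/
def Hom.leafEquiv {S T : PTree P} (k : S ⟶ T) : S.Leaf ≃ T.Leaf :=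
  (Hom.edge k).subtypeEquiv fun a => by
    refine ⟨Hom.leafPreserving k a, fun h => ?_⟩
    rintro ⟨n, rfl⟩
    exact h ⟨_, (Hom.t_comm k n).symm⟩

theorem leafProfile_congr {S T : PTree P} (h : cls S = cls T) :
    S.leafProfile = T.leafProfile := by
  obtain ⟨k⟩ := cls_eq_iff_hom.1 h
  rw [leafProfile, leafProfile, ← (Hom.leafEquiv k).sum_comp]
  refine Finset.sum_congr rfl fun l _ => ?_
  rw [cls_eq_iff_hom.2 ⟨Hom.θα k l.1⟩]
  rfl

/-- The tree with one edge, of colour `v`, and no nodes. -/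
def edgeTree (P : PolyEndo I E B) (v : I) : PTree P where
  A := Unit
  M := Empty
  N := Empty
  s := nofun
  p := nofun
  t := nofun
  root := ()
  t_injective := nofun
  s_injective := nofun
  compl_range_s := by ext; simp
  walk_root _ := ⟨0, rfl⟩
  α _ := v
  ε := nofun
  β := nofun
  sIso := nofun
  pIso := nofun
  tIso := nofun
  cartesian := nofun

/-- The vertex groups of `I` embed into the automorphism groups of the trees without nodes, so they
are finite as soon as the latter are. -/
theorem finite_colour_hom (hfin : ∀ T : PTree P, Finite (Aut T)) (v w : I) : Finite (v ⟶ w) := by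
  have := finite_hom (edgeTree P v) (edgeTree P w)
  let F (f : v ⟶ w) : edgeTree P v ⟶ edgeTree P w :=
    { edge := Equiv.refl _
      mark := Equiv.refl _
      node := Equiv.refl _
      s_comm := nofun
      p_comm := nofun
      t_comm := nofun
      θα _ := f
      θε := nofun
      θβ := nofun
      s_nat := nofun
      p_nat := nofun
      t_nat := nofun }
  exact Finite.of_injective F fun f f' h => 
    congrArg (fun k : edgeTree P v ⟶ edgeTree P w => (show v ⟶ w from Hom.θα k ())) h

/-- The multiset of isomorphism classes of the ideal trees above a cut. -/
noncomputable def crown (T : PTree P) (c : T.Cut) : Pi0 (PTree P) →₀ ℕ :=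
  ∑ l : c.toTree.Leaf, Finsupp.single (cls (T.sub (T.ideal l.1.1))) 1

/-- The class of the ideal tree above the leaf `l` of a cut identified with `S`. -/
noncomputable def crownLabel {S T : PTree P} {c : T.Cut} (σ : S ⟶ T.sub c) (l : S.Leaf) :
    Pi0 (PTree P) :=
  cls (T.sub (T.ideal (Hom.edge σ l.1).1))

theorem crown_eq_sum {S T : PTree P} {c : T.Cut} (σ : S ⟶ T.sub c) :
    T.crown c = ∑ l, Finsupp.single (crownLabel σ l) 1 :=
  ((Hom.leafEquiv σ).sum_comp
    fun l => Finsupp.single (cls (T.sub (T.ideal l.1.1))) 1).symm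

/-- A decomposition of `T` is a cut of `T` with an identification of its trunk with `S` and of the
trees of its crown with the `F l`. -/
noncomputable def decompEquiv (S : PTree P) (F : S.Leaf → PTree P) (T : PTree P) :
    (Σ x : Σ c : T.Cut, (S ⟶ T.sub c), ∀ l, (F l ⟶ T.sub (T.ideal (Hom.edge x.2 l.1).1))) ≃
      Decomp S F T :=
  (Equiv.sigmaCongr (β₂ := fun φ : {φ : Mor S T // φ.edge S.root = T.root} => ∀ l : S.Leaf,
      {τ : Mor (F l) T // τ.edge (F l).root = φ.1.edge l.1 ∧ τ.LeafPreserving})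
    (cutHomEquiv S T) fun _ => Equiv.piCongrRight fun l => idealHomEquiv (F l) T _).trans
  { toFun x := ⟨x.1.1, fun l => (x.2 l).1, x.1.2, fun l => (x.2 l).2.1, fun l => (x.2 l).2.2⟩
    invFun D := ⟨⟨D.trunk, D.trunk_root⟩, fun l => ⟨D.crown l, D.crown_root l, D.crown_leaf l⟩⟩
    left_inv _ := rfl
    right_inv _ := rfl }

variable (hfin : ∀ T : PTree P, Finite (Aut T))
include hfin

open Classical in
/-- Summing over cuts whose crown has a fixed class `m`, an identification of the trunk with `S`
and of the trees of the crown with fixed representatives gives a decomposition, that is, an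
isomorphism with a grafted tree. -/
theorem card_cuts (S T : PTree P) (m : Pi0 (PTree P) →₀ ℕ) :
    (∑ c : T.Cut, if T.crown c = m ∧ cls (T.sub c) = cls S then (1 : ℚ) else 0) =
      (Nat.card (Aut S) : ℚ)⁻¹ * ∑ f ∈ labellings S.Leaf m,
        (∏ l, (Nat.card (Aut (f l).out) : ℚ)⁻¹) *
          Nat.card (Σ h : Gluing S fun l => (f l).out, (graft h ⟶ T)) := by
  have hhom : ∀ S T : PTree P, Finite (S ⟶ T) := fun S T => finite_hom S T
  have (S T : PTree P) : Fintype (S ⟶ T) := Fintype.ofFinite _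
  -- a decomposition is a cut `c`, an identification `σ` of its trunk with `S`, and, for each leaf
  -- `l`, one of the `|Aut (f l)|` isomorphisms of the tree above `l` with the representative of `f l`
  have hdec (f : S.Leaf → Pi0 (PTree P)) :
      (Nat.card (Σ h : Gluing S fun l => (f l).out, (graft h ⟶ T)) : ℚ) =
        ∑ c : T.Cut, ∑ σ : S ⟶ T.sub c, (∏ l, (Nat.card (Aut (f l).out) : ℚ)) *
          if crownLabel σ = f then 1 else 0 := by
    rw [Nat.card_congr ((Decomp.equiv S _ T).trans (decompEquiv S _ T).symm), Nat.card_sigma,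
      Fintype.sum_sigma, Nat.cast_sum]
    refine Finset.sum_congr rfl fun c _ => ?_
    rw [Nat.cast_sum]
    refine Finset.sum_congr rfl fun σ _ => ?_
    rw [Nat.card_pi, Nat.cast_prod]
    have h1 (l : S.Leaf) : (Nat.card ((f l).out ⟶ T.sub (T.ideal (Hom.edge σ l.1).1)) : ℚ) =
        if crownLabel σ l = f l then (Nat.card (Aut (f l).out) : ℚ) else 0 := by
      have h0 := card_hom (f l).out (T.sub (T.ideal (Hom.edge σ l.1).1))
      rw [cls_out] at h0
      by_cases h : crownLabel σ l = f l
      · rw [if_pos h, h0, Nat.cast_inj]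
        exact (if_pos h.symm).trans (card_aut_congr (h.trans (cls_out _).symm))
      · rw [if_neg h, h0]
        exact Nat.cast_eq_zero.2 (if_neg (Ne.symm h))
    rw [Finset.prod_congr rfl fun l _ => h1 l, Fintype.prod_ite_zero]
    by_cases h : crownLabel σ = f
    · rw [if_pos fun l => congrFun h l, if_pos h, mul_one]
    · rw [if_neg fun h' => h (funext h'), if_neg h, mul_zero]
  have hS : (Nat.card (Aut S) : ℚ) ≠ 0 := card_aut_ne_zero S
  rw [eq_inv_mul_iff_mul_eq₀ hS]
  have h2 : ∀ f : S.Leaf → Pi0 (PTree P), (∏ l, (Nat.card (Aut (f l).out) : ℚ)⁻¹) *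
      Nat.card (Σ h : Gluing S fun l => (f l).out, (graft h ⟶ T)) =
        ∑ c : T.Cut, ∑ σ : S ⟶ T.sub c, if crownLabel σ = f then 1 else 0 := by
    intro f
    rw [hdec]
    simp only [← Finset.mul_sum]
    rw [← mul_assoc, ← Finset.prod_mul_distrib, Finset.prod_eq_one, one_mul]
    exact fun l _ => inv_mul_cancel₀ (card_aut_ne_zero _)
  rw [Finset.sum_congr rfl fun f _ => h2 f, Finset.sum_comm, Finset.mul_sum]
  refine Finset.sum_congr rfl fun c _ => ?_
  rw [Finset.sum_comm]
  -- each `σ` determines one labelling of the leaves of `S`, so the sum over `f` only records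
  -- whether the class of the crown is `m`
  have h3 : ∀ σ : S ⟶ T.sub c, (∑ f ∈ labellings S.Leaf m,
      if crownLabel σ = f then (1 : ℚ) else 0) = if T.crown c = m then 1 else 0 := by
    intro σ
    rw [Finset.sum_ite_eq]
    simp only [mem_labellings, crown_eq_sum σ]
  rw [Finset.sum_congr rfl fun σ _ => h3 σ, Finset.sum_const, Finset.card_univ,
    ← Nat.card_eq_fintype_card, card_hom, nsmul_eq_mul]
  by_cases h : cls (T.sub c) = cls S
  · rw [if_pos h.symm, card_aut_congr h]
    simp [h]
  · rw [if_neg (Ne.symm h)]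
    simp [h]

/-- Each gluing datum gives one isomorphism class of trees, which contributes `1` to the sum of the
`|Aut T|⁻¹` over the isomorphisms from grafted trees to `T`. -/
theorem finsum_card_graft_hom (S : PTree P) (F : S.Leaf → PTree P) :
    (fun x : Pi0 (PTree P) => (Nat.card (Aut x.out) : ℚ)⁻¹ *
      Nat.card (Σ h : Gluing S F, (graft h ⟶ x.out))).HasFiniteSupport ∧
    ∑ᶠ x : Pi0 (PTree P), (Nat.card (Aut x.out) : ℚ)⁻¹ *
      Nat.card (Σ h : Gluing S F, (graft h ⟶ x.out)) =
        ∏ l, (Nat.card ((F l).α (F l).root ⟶ S.α l.1) : ℚ) := by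
  classical
  have := finite_colour_hom hfin
  have := Fintype.ofFinite (Gluing S F)
  have := fun S T : PTree P => finite_hom S T
  have key (x : Pi0 (PTree P)) : (Nat.card (Aut x.out) : ℚ)⁻¹ *
      Nat.card (Σ h : Gluing S F, (graft h ⟶ x.out)) =
        Nat.card {h : Gluing S F // cls (graft h) = x} := by
    rw [Nat.card_sigma]
    simp only [card_hom, cls_out]
    rw [← Finset.sum_filter, Finset.sum_const, smul_eq_mul, Nat.card_eq_fintype_card (α := {_h // _}),
      Fintype.card_subtype, Nat.cast_mul, mul_comm, mul_assoc, mul_inv_cancel₀ (card_aut_ne_zero _),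
      mul_one]
  simp only [key]
  rw [← Nat.cast_prod, ← Nat.card_pi]
  exact finsum_card_fibre fun h : Gluing S F => cls (graft h)

end PTree

/-! ### Coefficients of power series -/

/-- The coefficients of a product of power series which are sums of multiples of the variables. -/
theorem coeff_prod_of_linear {ι σ : Type*} [Fintype ι] (g : ι → MvPowerSeries σ ℚ)
    (hg : ∀ i d, (∀ x, d ≠ Finsupp.single x 1) → MvPowerSeries.coeff d (g i) = 0) (m : σ →₀ ℕ) :
    MvPowerSeries.coeff m (∏ i, g i) =
      ∑ f ∈ labellings ι m, ∏ i, MvPowerSeries.coeff (Finsupp.single (f i) 1) (g i) := by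
  classical
  rw [MvPowerSeries.coeff_prod]
  symm
  refine Finset.sum_of_injOn
    (fun f => Finsupp.equivFunOnFinite.symm fun i => Finsupp.single (f i) 1) ?_ ?_ ?_ ?_
  · intro f _ f' _ h
    funext i
    have := DFunLike.congr_fun h i
    exact Finsupp.single_left_injective one_ne_zero this
  · intro f hf
    rw [Finset.mem_coe, mem_labellings] at hf
    rw [Finset.mem_coe, Finset.mem_finsuppAntidiag]
    exact ⟨hf, Finset.subset_univ _⟩
  -- a term which is not a labelling has a factor of degree different from 1
  · intro l hl hl'
    rw [Finset.mem_finsuppAntidiag] at hl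
    by_contra hne
    have h : ∀ i, ∃ x, l i = Finsupp.single x 1 := fun i => by
      by_contra! h
      exact hne (Finset.prod_eq_zero (Finset.mem_univ i) (hg i _ h))
    choose f hf using h
    refine hl' ⟨f, ?_, Finsupp.ext fun i => (hf i).symm⟩
    rw [Finset.mem_coe, mem_labellings, ← hl.1]
    exact Finset.sum_congr rfl fun i _ => (hf i).symm
  · intro f _
    rfl

theorem coeff_tensor {σ : Type*} (f g : MvPowerSeries σ ℚ) (d : σ ⊕ σ →₀ ℕ) :
    MvPowerSeries.coeff d (tensor f g) =
      MvPowerSeries.coeff (Finsupp.sumFinsuppEquivProdFinsupp d).1 f *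
        MvPowerSeries.coeff (Finsupp.sumFinsuppEquivProdFinsupp d).2 g := rfl

/-- Reindexing a sum whose terms vanish off the image of an injective map. -/
theorem finsum_eq_finsum_comp {α β : Type*} {i : α → β} (hi : Function.Injective i) (g : β → ℚ)
    (hg : ∀ b, (∀ a, b ≠ i a) → g b = 0) : ∑ᶠ b, g b = ∑ᶠ a, g (i a) := by
  rw [← finsum_mem_range hi, ← finsum_mem_univ]
  refine finsum_mem_inter_support_eq' _ _ _ fun b hb => ?_
  simp only [Set.mem_univ, true_iff]
  by_contra h
  exact hb (hg b fun a ha => h ⟨a, ha.symm⟩)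

namespace PolyEndo

section RelCard

variable {X : Type*} [Category X] (F : X ⥤ PTree P)

open Classical in
theorem coeff_relCard_single (z : Pi0 (PTree P)) :
    MvPowerSeries.coeff (Finsupp.single z 1) (relCard F) =
      ∑ᶠ x : Pi0 X, if cls (F.obj x.out) = z then (Nat.card (Aut x.out) : ℚ)⁻¹ else 0 := by
  refine finsum_congr fun x => ?_
  rw [MvPowerSeries.coeff_smul, MvPowerSeries.coeff_X, mul_ite, mul_one, mul_zero]
  exact if_congr ((Finsupp.single_left_inj one_ne_zero).trans eq_comm) rfl rfl

theorem coeff_relCard_of_ne {d : Pi0 (PTree P) →₀ ℕ} (hd : ∀ z, d ≠ Finsupp.single z 1) :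
    MvPowerSeries.coeff d (relCard F) = 0 := by
  classical
  refine (finsum_congr fun x => ?_).trans finsum_zero
  rw [MvPowerSeries.coeff_smul, MvPowerSeries.coeff_X, if_neg (hd _), mul_zero]

/-- A full subgroupoid of `P`-trees contributes `1 / |Aut T|` at each of its classes. -/
theorem coeff_relCard_of_fullyFaithful [F.Full] [F.Faithful] (x : X) :
    MvPowerSeries.coeff (Finsupp.single (cls (F.obj x)) 1) (relCard F) =
      (Nat.card (Aut (F.obj x)) : ℚ)⁻¹ := by
  classical
  rw [coeff_relCard_single, finsum_eq_single _ (cls x)]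
  · have h : cls (F.obj (cls x).out) = cls (F.obj x) := by
      obtain ⟨e⟩ := cls_eq_iff.1 (cls_out (cls x))
      exact cls_eq_iff.2 ⟨F.mapIso e⟩
    rw [if_pos h, card_aut_congr (cls_out (cls x)), inv_inj, Nat.cast_inj]
    exact Nat.card_congr ((Functor.FullyFaithful.ofFullyFaithful F).isoEquiv (X := x) (Y := x))
  · intro y hy
    refine if_neg fun h => hy ?_
    obtain ⟨e⟩ := cls_eq_iff.1 h
    rw [← cls_out y]
    exact cls_eq_iff.2 ⟨F.preimageIso e⟩

end RelCard

theorem coeff_green (x : Pi0 (PTree P)) :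
    MvPowerSeries.coeff (Finsupp.single x 1) P.green = (Nat.card (Aut x.out) : ℚ)⁻¹ := by
  have := coeff_relCard_of_fullyFaithful (𝟭 (PTree P)) x.out
  rw [Functor.id_obj, cls_out] at this
  exact this

theorem coeff_greenLeaf (S : PTree P) :
    MvPowerSeries.coeff (Finsupp.single (cls S) 1) (P.greenLeaf S.leafProfile) =
      (Nat.card (Aut S) : ℚ)⁻¹ :=
  coeff_relCard_of_fullyFaithful (ObjectProperty.ι fun T : PTree P => T.leafProfile = S.leafProfile)
    ⟨S, rfl⟩

theorem coeff_greenLeaf_of_ne {S : PTree P} {n : Pi0 I →₀ ℕ} (h : S.leafProfile ≠ n) :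
    MvPowerSeries.coeff (Finsupp.single (cls S) 1) (P.greenLeaf n) = 0 := by
  classical
  rw [greenLeaf, coeff_relCard_single]
  refine (finsum_congr fun x => if_neg fun hx => h ?_).trans finsum_zero
  rw [← PTree.leafProfile_congr hx]
  exact x.out.property

section Fibre

variable (hfin : ∀ T : PTree P, Finite (Aut T))
include hfin

theorem finite_aut_costructuredArrow (v : I) (x : CostructuredArrow (PTree.rootMap P) v) :
    Finite (Aut x) := by
  have := hfin x.left
  refine Finite.of_injective (β := Aut x.left)
    (fun e => (CostructuredArrow.proj (PTree.rootMap P) v).mapIso e) fun e e' h => ?_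
  have h' : e.hom.left = e'.hom.left := congrArg Iso.hom h
  ext
  exact h'

theorem relFinite_costructuredArrow (v : I) :
    RelFinite (CostructuredArrow.proj (PTree.rootMap P) v) := by
  refine ⟨fun y => ?_, finite_aut_costructuredArrow hfin v⟩
  have := PTree.finite_colour_hom hfin ((PTree.rootMap P).obj y.out) v
  refine (Set.finite_range fun ψ : (PTree.rootMap P).obj y.out ⟶ v =>
    cls (CostructuredArrow.mk ψ)).subset fun x hx => ?_
  have hx : cls x.out.left = y := hx
  rw [← cls_out y] at hx
  obtain ⟨k⟩ := cls_eq_iff_hom.1 hx.symm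
  refine ⟨(PTree.rootMap P).map k ≫ x.out.hom, ?_⟩
  exact (cls_eq_iff.2 ⟨CostructuredArrow.isoMk ((Groupoid.isoEquivHom _ _).symm k) rfl⟩).trans
    (cls_out x)

/-- The coefficients of `G_v`, by orbit-stabilizer. -/
theorem coeff_greenRoot (v : I) (z : Pi0 (PTree P)) :
    MvPowerSeries.coeff (Finsupp.single z 1) (P.greenRoot v) =
      Nat.card (z.out.α z.out.root ⟶ v) * (Nat.card (Aut z.out) : ℚ)⁻¹ := by
  classical
  have := PTree.finite_colour_hom hfin ((PTree.rootMap P).obj z.out) v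
  have := finite_aut_costructuredArrow hfin v
  rw [greenRoot, coeff_relCard_single]
  have key (x : Pi0 (CostructuredArrow (PTree.rootMap P) v)) :
      (if cls ((CostructuredArrow.proj (PTree.rootMap P) v).obj x.out) = z then
        (Nat.card (Aut x.out) : ℚ)⁻¹ else 0) =
      Nat.card {ψ : (PTree.rootMap P).obj z.out ⟶ v // cls (CostructuredArrow.mk ψ) = x} *
        (Nat.card (Aut z.out) : ℚ)⁻¹ := by
    have h := card_costructuredArrow (PTree.rootMap P) z.out v x.out
    rw [card_hom, cls_out, cls_out] at h
    have hx : (Nat.card (Aut x.out) : ℚ) ≠ 0 := card_aut_ne_zero _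
    have hz : (Nat.card (Aut z.out) : ℚ) ≠ 0 := card_aut_ne_zero _
    -- clear the denominators
    rw [eq_mul_inv_iff_mul_eq₀ hz, ← mul_left_inj' hx, ← Nat.cast_mul, h]
    by_cases hxz : cls x.out.left = z
    · have hzx : cls z.out = cls x.out.left := (cls_out z).trans hxz.symm
      rw [if_pos hxz.symm, ← card_aut_congr hzx]
      refine (congrArg (· * _ * _) (if_pos hxz)).trans ?_
      field_simp
    · rw [if_neg (Ne.symm hxz)]
      refine (congrArg (· * _ * _) (if_neg hxz)).trans ?_
      simp
  rw [finsum_congr key, ← finsum_mul, (finsum_card_fibre _).2]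
  rfl

theorem coeff_greenRoot_congr {v w : I} (h : cls v = cls w) (z : Pi0 (PTree P)) :
    MvPowerSeries.coeff (Finsupp.single z 1) (P.greenRoot v) =
      MvPowerSeries.coeff (Finsupp.single z 1) (P.greenRoot w) := by
  obtain ⟨e⟩ := cls_eq_iff.1 h
  rw [coeff_greenRoot hfin, coeff_greenRoot hfin, Nat.card_congr e.homToEquiv]

/-- At a leaf profile, `G^n` is the product of the `G_v` over the colours `v` of the leaves, so that
its coefficients are sums over the labellings of the leaves by classes of trees. -/
theorem coeff_greenPow (S : PTree P) (m : Pi0 (PTree P) →₀ ℕ) :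
    MvPowerSeries.coeff m (P.greenPow S.leafProfile) =
      ∑ f ∈ labellings S.Leaf m, ∏ l, (Nat.card ((f l).out.α (f l).out.root ⟶ S.α l.1) *
        (Nat.card (Aut (f l).out) : ℚ)⁻¹) := by
  have h : P.greenPow S.leafProfile = ∏ l : S.Leaf, P.greenRoot (cls (S.α l.1)).out := by
    rw [greenPow, PTree.leafProfile, ← Finsupp.prod_finsetSum_index
      (fun v => pow_zero _) (fun v k k' => pow_add _ _ _)]
    exact Finset.prod_congr rfl fun l _ => 
      (Finsupp.prod_single_index (h := fun (v : Pi0 I) k => P.greenRoot v.out ^ k) (pow_zero _)).trans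
        (pow_one _)
  rw [h, coeff_prod_of_linear (fun l : S.Leaf => P.greenRoot (cls (S.α l.1)).out)
    fun l d hd => coeff_relCard_of_ne _ hd]
  refine Finset.sum_congr rfl fun f _ => Finset.prod_congr rfl fun l _ => ?_
  rw [coeff_greenRoot_congr hfin (cls_out (cls (S.α l.1))), coeff_greenRoot hfin]

end Fibre

/-! ### The comultiplication -/

theorem δAbove_eq_monomial (T : PTree P) (c : T.Cut) :
    P.δAbove T c = MvPowerSeries.monomial (T.crown c) 1 := by
  rw [δAbove, PTree.crown, Finset.prod_congr rfl fun l _ => MvPowerSeries.X_def _,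
    MvPowerSeries.prod_monomial, Finset.prod_const_one]

open Classical in
theorem coeff_cutSum (T : PTree P) (d : Pi0 (PTree P) ⊕ Pi0 (PTree P) →₀ ℕ) :
    MvPowerSeries.coeff d (P.cutSum T) = ∑ c : T.Cut,
      if T.crown c = (Finsupp.sumFinsuppEquivProdFinsupp d).1 ∧
        Finsupp.single (cls (T.sub c)) 1 = (Finsupp.sumFinsuppEquivProdFinsupp d).2
      then (1 : ℚ) else 0 := by
  rw [cutSum, map_sum]
  refine Finset.sum_congr rfl fun c _ => ?_
  rw [coeff_tensor, δAbove_eq_monomial, MvPowerSeries.coeff_monomial, MvPowerSeries.coeff_X,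
    ite_zero_mul_ite_zero, mul_one]
  exact if_congr (and_congr eq_comm eq_comm) rfl rfl

theorem coeff_cutSum_of_ne (T : PTree P) {d : Pi0 (PTree P) ⊕ Pi0 (PTree P) →₀ ℕ}
    (hd : ∀ S : PTree P, (Finsupp.sumFinsuppEquivProdFinsupp d).2 ≠ Finsupp.single (cls S) 1) :
    MvPowerSeries.coeff d (P.cutSum T) = 0 := by
  rw [coeff_cutSum]
  exact Finset.sum_eq_zero fun c _ => if_neg fun h => hd _ h.2.symm

section

variable (hfin : ∀ T : PTree P, Finite (Aut T))
include hfin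

/-- The coefficients of `Δ(δ_T)` count the isomorphisms from grafted trees to `T`. -/
theorem coeff_cutSum_of_eq (S T : PTree P) {d : Pi0 (PTree P) ⊕ Pi0 (PTree P) →₀ ℕ}
    (hd : (Finsupp.sumFinsuppEquivProdFinsupp d).2 = Finsupp.single (cls S) 1) :
    MvPowerSeries.coeff d (P.cutSum T) = (Nat.card (Aut S) : ℚ)⁻¹ *
      ∑ f ∈ labellings S.Leaf (Finsupp.sumFinsuppEquivProdFinsupp d).1,
        (∏ l, (Nat.card (Aut (f l).out) : ℚ)⁻¹) *
          Nat.card (Σ h : PTree.Gluing S fun l => (f l).out, (PTree.graft h ⟶ T)) := by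
  rw [coeff_cutSum, ← PTree.card_cuts hfin]
  refine Finset.sum_congr rfl fun c _ => ?_
  congr 1
  rw [hd, Finsupp.single_left_inj one_ne_zero]

/-- `Δ(δ_T)` is an isomorphism invariant because isomorphisms `T ≅ T'` act on the isomorphisms from
grafted trees. -/
theorem cutSum_congr {T T' : PTree P} (h : cls T = cls T') : P.cutSum T = P.cutSum T' := by
  ext d
  by_cases hd : ∃ S : PTree P,
      (Finsupp.sumFinsuppEquivProdFinsupp d).2 = Finsupp.single (cls S) 1
  · obtain ⟨S, hS⟩ := hd
    obtain ⟨e⟩ := cls_eq_iff.1 h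
    rw [coeff_cutSum_of_eq hfin S T hS, coeff_cutSum_of_eq hfin S T' hS]
    congr 1
    refine Finset.sum_congr rfl fun f _ => ?_
    rw [Nat.card_congr (Equiv.sigmaCongrRight fun h =>
      (e.homToEquiv : (PTree.graft h ⟶ T) ≃ _))]
  · push Not at hd
    rw [coeff_cutSum_of_ne T hd, coeff_cutSum_of_ne T' hd]

theorem hasSubst_comulGen : MvPowerSeries.HasSubst P.comulGen where
  const_coeff x := by
    have h : MvPowerSeries.coeff 0 (P.comulGen x) = 0 :=
      -- the monomial `1` does not involve a variable `1 ⊗ δ_S`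
      coeff_cutSum_of_ne _ fun S h => by
      have := DFunLike.congr_fun h (cls S)
      simp at this
    rw [← MvPowerSeries.coeff_zero_eq_constantCoeff_apply, h]
    exact IsNilpotent.zero
  coeff_zero d := by
    by_cases hd : ∃ S : PTree P,
        (Finsupp.sumFinsuppEquivProdFinsupp d).2 = Finsupp.single (cls S) 1
    · obtain ⟨S, hS⟩ := hd
      have := PTree.finite_colour_hom hfin
      refine ((labellings S.Leaf (Finsupp.sumFinsuppEquivProdFinsupp d).1).finite_toSet.biUnion
        fun f _ => Set.finite_range fun h : PTree.Gluing S fun l => (f l).out =>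
          cls (PTree.graft h)).subset fun x hx => ?_
      have hx : MvPowerSeries.coeff d (P.cutSum x.out) ≠ 0 := hx
      rw [coeff_cutSum_of_eq hfin S _ hS] at hx
      obtain ⟨f, hf, hfx⟩ := Finset.exists_ne_zero_of_sum_ne_zero (right_ne_zero_of_mul hx)
      obtain ⟨⟨h, k⟩⟩ := (Nat.card_ne_zero.1 (Nat.cast_ne_zero.1 (right_ne_zero_of_mul hfx))).1
      refine Set.mem_biUnion hf ⟨h, ?_⟩
      rw [← cls_out x]
      exact cls_eq_iff_hom.2 ⟨k⟩
    · push Not at hd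
      refine Set.finite_empty.subset fun x hx => hx (coeff_cutSum_of_ne _ hd)

theorem coeff_comul_green (d : Pi0 (PTree P) ⊕ Pi0 (PTree P) →₀ ℕ) :
    MvPowerSeries.coeff d (P.comul P.green) =
      ∑ᶠ x : Pi0 (PTree P), (Nat.card (Aut x.out) : ℚ)⁻¹ *
        MvPowerSeries.coeff d (P.cutSum x.out) := by
  rw [comul, MvPowerSeries.coeff_subst (hasSubst_comulGen hfin),
    finsum_eq_finsum_comp (Finsupp.single_left_injective one_ne_zero)]
  · refine finsum_congr fun x => ?_
    rw [coeff_green, smul_eq_mul]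
    exact congrArg (_ * MvPowerSeries.coeff d ·)
      ((Finsupp.prod_single_index (h := fun x k => P.comulGen x ^ k) (pow_zero _)).trans
        (pow_one _))
  · intro e he
    rw [green, coeff_relCard_of_ne _ he, zero_smul]

/-- The identity `Δ(G) = ∑ G^n ⊗ g_n` at the monomials whose second tensor factor is `δ_S`: both sides are sums over the labellings of the leaves of `S` by
classes of trees. -/
theorem coeff_comul_green_of_eq (S : PTree P) {d : Pi0 (PTree P) ⊕ Pi0 (PTree P) →₀ ℕ}
    (hd : (Finsupp.sumFinsuppEquivProdFinsupp d).2 = Finsupp.single (cls S) 1) :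
    MvPowerSeries.coeff d (P.comul P.green) =
      MvPowerSeries.coeff (Finsupp.sumFinsuppEquivProdFinsupp d).1 (P.greenPow S.leafProfile) *
        (Nat.card (Aut S) : ℚ)⁻¹ := by
  have hx (x : Pi0 (PTree P)) : (Nat.card (Aut x.out) : ℚ)⁻¹ *
      MvPowerSeries.coeff d (P.cutSum x.out) =
        ∑ f ∈ labellings S.Leaf (Finsupp.sumFinsuppEquivProdFinsupp d).1,
          ((Nat.card (Aut S) : ℚ)⁻¹ * ∏ l, (Nat.card (Aut (f l).out) : ℚ)⁻¹) *
            ((Nat.card (Aut x.out) : ℚ)⁻¹ * Nat.card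
              (Σ h : PTree.Gluing S fun l => (f l).out, (PTree.graft h ⟶ x.out))) := by
    rw [coeff_cutSum_of_eq hfin S _ hd, Finset.mul_sum, Finset.mul_sum]
    exact Finset.sum_congr rfl fun f _ => by ring
  rw [coeff_comul_green hfin, finsum_congr hx, finsum_sum_comm, coeff_greenPow hfin, Finset.sum_mul]
  · refine Finset.sum_congr rfl fun f _ => ?_
    rw [← mul_finsum, (PTree.finsum_card_graft_hom hfin S _).2, Finset.prod_mul_distrib]
    ring
  · intro f _
    refine ((PTree.finsum_card_graft_hom hfin S fun l => (f l).out).1).subset fun x hx => ?_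
    exact right_ne_zero_of_mul hx

theorem isFormalSum_comul_green :
    IsFormalSum (fun n : Pi0 I →₀ ℕ => tensor (P.greenPow n) (P.greenLeaf n))
      (P.comul P.green) := by
  intro d
  simp only [coeff_tensor]
  by_cases hd : ∃ S : PTree P,
      (Finsupp.sumFinsuppEquivProdFinsupp d).2 = Finsupp.single (cls S) 1
  · obtain ⟨S, hS⟩ := hd
    rw [hS]
    refine ⟨(Set.finite_singleton S.leafProfile).subset fun n hn => ?_, ?_⟩
    · by_contra h
      exact hn (by rw [coeff_greenLeaf_of_ne (Ne.symm h), mul_zero])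
    -- only the leaf profile of `S` contributes
    · rw [finsum_eq_single _ S.leafProfile fun n hn => by
        rw [coeff_greenLeaf_of_ne (Ne.symm hn), mul_zero], coeff_greenLeaf,
        coeff_comul_green_of_eq hfin S hS]
  · push Not at hd
    have h0 (n : Pi0 I →₀ ℕ) : MvPowerSeries.coeff (Finsupp.sumFinsuppEquivProdFinsupp d).2
        (P.greenLeaf n) = 0 :=
      coeff_relCard_of_ne _ fun z hz => hd z.out (by rw [hz, cls_out])
    simp only [h0, mul_zero, ne_eq, not_true_eq_false, Set.ofPred_false, Set.finite_empty, true_and,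
      finsum_zero]
    rw [coeff_comul_green hfin]
    exact (finsum_congr fun x => by rw [coeff_cutSum_of_ne _ hd, mul_zero]).trans finsum_zero

end

end PolyEndo

end FaaDiBruno

open CategoryTheory FaaDiBruno in
theorem mainTheorem2 {I E B : Type*} [Groupoid I] [Groupoid E] [Groupoid B] (P : PolyEndo I E B)
    (hfin : ∀ T : PTree P, Finite (Aut T)) :
    (∀ T : PTree P, P.comulGen (cls T) = P.cutSum T) ∧
    MvPowerSeries.HasSubst P.comulGen ∧
    (∀ v : I, PolyEndo.RelFinite (CostructuredArrow.proj (PTree.rootMap P) v)) ∧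
    IsFormalSum (fun n : Pi0 I →₀ ℕ => tensor (P.greenPow n) (P.greenLeaf n))
      (P.comul P.green) :=
  ⟨fun T => PolyEndo.cutSum_congr hfin (cls_out (cls T)), PolyEndo.hasSubst_comulGen hfin,
    PolyEndo.relFinite_costructuredArrow hfin, PolyEndo.isFormalSum_comul_green hfin⟩
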